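/- Model. A seller offers a freely replicable good to $n$ buyers. Buyer $i$ has a private type $t_i=(v_i,(\eta_{j\gets i})_{j\ne i})$: her value $v_i\in[\underline v_i,\overline v_i]\subset[0,\infty)$ for the good, and the externalities $\eta_{j\gets i}\ge 0$ (each in a bounded interval) that she causes on the others. If allocations are $x\in[0,1]^n$ and payments are $p\in[0,\infty)^n$, her utility is $v_ix_i-\sum_{j\neq i}\eta_{i\gets j}x_j-p_i$. Types of different buyers are independent; $v_i$ is independent of $(\eta_{j\gets i})_{j\ne i}$ and has a density $f_i$ on $[\underline v_i,\overline v_i]$ with distribution function $F_i$. Put $c_i=\sum_{j\ne i}\mathbb E[\eta_{j\gets i}]$, and assume that $v\mapsto vf_i(v)-(1-F_i(v))-f_i(v)c_i$ is non-decreasing on $[\underline v_i,\overline v_i]$ for each $i$. A mechanism consists of an allocation and a payment for every vector of bids, where a bid is a type or non-participation, and a buyer who does not participate gets and pays nothing. It is BNIC if, in expectation over the other buyers' truthful bids, bidding her true type is optimal for every type of every buyer among all bids that are types, and interim IR if bidding truthfully is, in the same sense, at least as good as not participating. The revenue $\mathrm{Rev}$ of a mechanism is its expected total payment under truthful bidding.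 In the posted-price mechanism with thresholds $\tau=(\tau_1,\dots,\tau_n)$, buyer $i$ gets the good iff $v_i\ge\tau_i$, and she pays $\tau_i$ if she gets it, plus $\mathbb E[\eta_{i\gets j}]$ for every $j\ne i$ who does not get it; write $\mathrm{Rev}(\tau)$ for its revenue. Algorithm. Fix parameters $\delta,\gamma>0$ and initial thresholds $\tau^1\in\prod_i[\underline v_i,\overline v_i]$. In rounds $k=1,2,\dots$ fresh types are drawn independently from the type distribution, and independent $u_i^k$ are drawn uniformly from $[-1,1]$, independently of the types. The price $\tau_i^k+\delta u_i^k$ is posted to buyer $i$, the decision $X_i^k=\mathbf 1\{v_i^k\ge\tau_i^k+\delta u_i^k\}$ is observed, and $$\tau_i^{k+1}=\Pi_i\Big(\tau_i^k+\gamma\,H_i(\tau_i^k+\delta u_i^k,X_i^k)\,\frac{u_i^k}{\delta}\Big),\qquad H_i(p,X)=p-(1-X)(p-c_i),$$ where $\Pi_i$ is the projection onto $[\underline v_i+\delta,\overline v_i-\delta]$. Let $\overline\tau_K=\frac1K\sum_{k=1}^K\tau^k$. Claim. For all real $w>0$ and $B$ there is a constant $C$ such that for every integer $K\ge1$ there are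 $\gamma>0$ and $\delta\in(0,w/2)$ with the following property. For every $n$ and every market as above with $\overline v_i-\underline v_i\ge w$, $\overline v_i\le B$ and $c_i\le B$ for all $i$, and for every choice of $\tau^1$, the random variable $\mathrm{Rev}(\overline\tau_K)$ is integrable, and $$\mathrm{Rev}(\tau)-\mathbb E\big[\mathrm{Rev}(\overline\tau_K)\big]\le C\,\frac{n}{K^{1/4}}$$ for every $\tau\in\prod_i[\underline v_i,\overline v_i]$ (in particular for revenue-maximizing thresholds $\tau^\star$), and likewise $$\mathrm{Rev}(x,p)-\mathbb E\big[\mathrm{Rev}(\overline\tau_K)\big]\le C\,\frac{n}{K^{1/4}}$$ for every BNIC and interim IR mechanism $(x,p)$ (with measurable allocations and payments, and integrable payments). -/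

import Mathlib

open MeasureTheory ProbabilityTheory
open scoped ENNReal

noncomputable section

namespace DataMarket

/-- The private type `(v_i, (η_{j←i})_{j ≠ i})` of bidder `i`: her value for the good, and the
externalities that she causes on the other bidders. -/
abbrev BidderType (n : ℕ) (i : Fin n) : Type := ℝ × ({j : Fin n // j ≠ i} → ℝ)

/-- Vectors of types, one for each bidder. -/
abbrev Profile (n : ℕ) : Type := ∀ i : Fin n, BidderType n i

/-- Vectors of bids; the bid `none` means that the bidder does not participate. -/
abbrev BidProfile (n : ℕ) : Type := ∀ i : Fin n, Option (BidderType n i)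

/-- Everybody participates and bids her type. -/
def truthful {n : ℕ} (t : Profile n) : BidProfile n := fun i => some (t i)

/-- The externality `η_{i←j}` that bidder `j ≠ i` causes on bidder `i`. It belongs to the type
of bidder `j`. -/
def externality {n : ℕ} (t : Profile n) (i : Fin n) (j : {j : Fin n // j ≠ i}) : ℝ :=
  (t j).2 ⟨i, j.2.symm⟩

/-- The (prior) data of a market with `n` bidders. The value `v_i` has a density on
`[vlo i, vhi i]`, and `(η_{j←i})_{j ≠ i}` has law `extLaw i` on a box. -/
structure Market (n : ℕ) where
  /-- lower end of the range of values -/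
  vlo : Fin n → ℝ
  /-- upper end of the range of values -/
  vhi : Fin n → ℝ
  vlo_nonneg : ∀ i, 0 ≤ vlo i
  vlo_lt_vhi : ∀ i, vlo i < vhi i
  /-- density of `v_i` -/
  density : Fin n → ℝ → ℝ
  density_measurable : ∀ i, Measurable (density i)
  density_nonneg : ∀ i, ∀ v ∈ Set.Icc (vlo i) (vhi i), 0 ≤ density i v
  density_total : ∀ i, ∫⁻ v in Set.Icc (vlo i) (vhi i), ENNReal.ofReal (density i v) = 1
  /-- `etalo i j` is the lower end of the range of `η_{i←j}` -/
  etalo : Fin n → Fin n → ℝ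
  /-- `etahi i j` is the upper end of the range of `η_{i←j}` -/
  etahi : Fin n → Fin n → ℝ
  etalo_nonneg : ∀ i j, 0 ≤ etalo i j
  /-- law of `(η_{j←i})_{j ≠ i}` -/
  extLaw : ∀ i : Fin n, Measure ({j : Fin n // j ≠ i} → ℝ)
  extLaw_prob : ∀ i, IsProbabilityMeasure (extLaw i)
  extLaw_range : ∀ i, ∀ᵐ η ∂(extLaw i), ∀ j : {j : Fin n // j ≠ i}, η j ∈ Set.Icc (etalo j i) (etahi j i)

namespace Market

variable {n : ℕ} (M : Market n)

/-- The set `T_i` of possible types of bidder `i`. -/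
def typeSpace (i : Fin n) : Set (BidderType n i) :=
  {t | t.1 ∈ Set.Icc (M.vlo i) (M.vhi i) ∧
    ∀ j : {j : Fin n // j ≠ i}, t.2 j ∈ Set.Icc (M.etalo j i) (M.etahi j i)}

/-- The law of `v_i`. -/
def valueLaw (i : Fin n) : Measure ℝ :=
  (volume.restrict (Set.Icc (M.vlo i) (M.vhi i))).withDensity
    (fun v => ENNReal.ofReal (M.density i v))

/-- The distribution function `F_{v_i}`. -/
def valueCDF (i : Fin n) (x : ℝ) : ℝ := (M.valueLaw i).real (Set.Iic x)

/-- The law of the types of all bidders: types of different bidders are independent, and the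
value of a bidder is independent of the externalities that she causes. -/
def typeLaw : Measure (Profile n) :=
  Measure.pi fun i => (M.valueLaw i).prod (M.extLaw i)

/-- The expectation `E[η_{i←j}]`. -/
def meanExt (i : Fin n) (j : {j : Fin n // j ≠ i}) : ℝ :=
  ∫ η, η ⟨i, j.2.symm⟩ ∂(M.extLaw j)

/-- The expected total externality `∑_{j ≠ i} E[η_{j←i}]` that bidder `i` causes. -/
def causedExt (i : Fin n) : ℝ := ∑ j : {j : Fin n // j ≠ i}, ∫ η, η j ∂(M.extLaw i)

/-- The regularity condition on the distribution of values. -/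
def Regular : Prop :=
  ∀ i, MonotoneOn
    (fun v => v * M.density i v - (1 - M.valueCDF i v) - M.density i v * M.causedExt i)
    (Set.Icc (M.vlo i) (M.vhi i))

end Market

/-- An auction mechanism: allocations and payments as functions of the bids. -/
structure Mechanism (n : ℕ) where
  /-- allocation function -/
  alloc : BidProfile n → Fin n → ℝ
  /-- payment function -/
  pay : BidProfile n → Fin n → ℝ

/-- The quasilinear utility of bidder `i` with types `t`, allocations `x` and payments `p`. -/
def utility {n : ℕ} (t : Profile n) (x p : Fin n → ℝ) (i : Fin n) : ℝ :=
  (t i).1 * x i - ∑ j : {j : Fin n // j ≠ i}, externality t i j * x j - p i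

namespace Mechanism

variable {n : ℕ} (m : Mechanism n) (M : Market n)

/-- Allocations are in `[0,1]`, payments are non-negative, a bidder who does not participate
gets and pays nothing; and the expectations below are meaningful. -/
structure Feasible : Prop where
  alloc_mem : ∀ b i, m.alloc b i ∈ Set.Icc (0 : ℝ) 1
  pay_nonneg : ∀ b i, 0 ≤ m.pay b i
  outside : ∀ b i, b i = none → m.alloc b i = 0 ∧ m.pay b i = 0
  alloc_measurable : ∀ i, Measurable fun t : Profile n => m.alloc (truthful t) i
  alloc_out_measurable : ∀ i j,
    Measurable fun t : Profile n => m.alloc (Function.update (truthful t) i none) j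
  pay_measurable : ∀ i, Measurable fun t : Profile n => m.pay (truthful t) i
  pay_integrable : ∀ i, Integrable (fun t => m.pay (truthful t) i) M.typeLaw
  pay_interim_integrable : ∀ i, ∀ ti ∈ M.typeSpace i,
    Integrable (fun t => m.pay (Function.update (truthful t) i (some ti)) i) M.typeLaw

/-- The interim expected utility `V_i(b; ti)` of bidder `i` if she bids `b`, has true type `ti`,
and the others bid truthfully. As types of different bidders are independent, conditioning on
the type of bidder `i` amounts to fixing that coordinate. -/
def interimUtility (i : Fin n) (b : Option (BidderType n i)) (ti : BidderType n i) : ℝ :=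
  ∫ t, utility (Function.update t i ti)
    (m.alloc (Function.update (truthful t) i b)) (m.pay (Function.update (truthful t) i b)) i
    ∂M.typeLaw

/-- Bayes-Nash incentive compatibility. -/
def BNIC : Prop :=
  ∀ i, ∀ ti ∈ M.typeSpace i, ∀ si ∈ M.typeSpace i,
    m.interimUtility M i (some si) ti ≤ m.interimUtility M i (some ti) ti

/-- Interim individual rationality. -/
def InterimIR : Prop :=
  ∀ i, ∀ ti ∈ M.typeSpace i, m.interimUtility M i none ti ≤ m.interimUtility M i (some ti) ti

/-- The revenue: the expected total payment under truthful bidding. -/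
def rev : ℝ := ∫ t, ∑ i, m.pay (truthful t) i ∂M.typeLaw

end Mechanism

open Classical in
/-- The posted-price mechanism with thresholds `τ`. When everybody participates, bidder `i` gets
the good iff `v_i ≥ τ_i`, and pays `τ_i` if she gets it, plus `E[η_{i←j}]` for every other
bidder `j` who does not get it. If some bidder does not participate, then all participating
bidders get the good. -/
def postedPrice {n : ℕ} (M : Market n) (τ : Fin n → ℝ) : Mechanism n :=
  let x : BidProfile n → Fin n → ℝ := fun b i =>
    match b i with
    | none => 0
    | some ti => if (∃ j, b j = none) ∨ τ i ≤ ti.1 then 1 else 0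
  { alloc := x
    pay := fun b i =>
      match b i with
      | none => 0
      | some _ => x b i * τ i + ∑ j : {j : Fin n // j ≠ i}, M.meanExt i j * (1 - x b j) }

/-- The estimate `H_i(p, X)` formed from the decision `X = 1{v ≥ p}` of bidder `i` with value `v`
when the price `p` is posted to her. -/
def revEstimate {n : ℕ} (M : Market n) (i : Fin n) (p v : ℝ) : ℝ :=
  p - (1 - if p ≤ v then 1 else 0) * (p - M.causedExt i)

/-- The law of `n` independent uniform variables on `[-1,1]`. -/
def noiseLaw (n : ℕ) : Measure (Fin n → ℝ) :=
  Measure.pi fun _ => cond volume (Set.Icc (-1 : ℝ) 1)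

/-- The thresholds of the learning algorithm: `thresholds … k` is the vector after `k` updates,
so that `thresholds … 0` is the initial vector `τ₁`. In each round bidder `i`, with value
`(t k i).1`, is offered the perturbed price `τ_i + δ u_i`, and `τ_i` is updated by projected
gradient ascent, with step size `γ` and the derivative estimate `H_i(τ_i + δ u_i, X_i) u_i / δ`;
the projection is on the interval of thresholds whose perturbations stay in the range of
values. -/
def thresholds {n : ℕ} (M : Market n) (δ γ : ℝ) (τ₁ : Fin n → ℝ)
    (t : ℕ → Profile n) (u : ℕ → Fin n → ℝ) : ℕ → Fin n → ℝ
  | 0 => τ₁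
  | k + 1 => fun i =>
    let τ := thresholds M δ γ τ₁ t u k i
    max (M.vlo i + δ) (min (M.vhi i - δ)
      (τ + γ * (revEstimate M i (τ + δ * u k i) (t k i).1 * u k i / δ)))

/-- The average of the first `K` vectors of thresholds. -/
def avgThresholds {n : ℕ} (M : Market n) (δ γ : ℝ) (τ₁ : Fin n → ℝ)
    (t : ℕ → Profile n) (u : ℕ → Fin n → ℝ) (K : ℕ) : Fin n → ℝ :=
  fun i => (∑ k ∈ Finset.range K, thresholds M δ γ τ₁ t u k i) / K

/-- The revenue of the posted-price mechanism at the average of the first `K` vectors of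
thresholds. -/
def learnedRev {n : ℕ} (M : Market n) (δ γ : ℝ) (τ₁ : Fin n → ℝ)
    (t : ℕ → Profile n) (u : ℕ → Fin n → ℝ) (K : ℕ) : ℝ :=
  (postedPrice M (avgThresholds M δ γ τ₁ t u K)).rev M

end DataMarket

end

/-!
The revenue of posted prices separates into a sum over the buyers: the threshold `τ_i` brings in
`R_i(τ_i) = τ_i (1 - F_i(τ_i)) + c_i F_i(τ_i)`, since buyer `i` pays `τ_i`, or else the others
pay the `c_i` that they are spared in expected externalities. The regularity condition
says that `R_i'` is non-increasing, so `R_i` is concave.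

*Learning.* The estimate `H_i` has mean `R_i` at the posted price, so integration by parts against
`1 - x ^ 2` shows that the mean of the update direction is a third of the derivative of the
average of `R_i(τ + δ x)` over the density `3 / 4 * (1 - x ^ 2)` on `[-1, 1]`. This average is
concave and lies below `R_i`. The algorithm is thus projected stochastic gradient ascent for a
concave function close to `R_i`, with gradient estimates bounded by `B / δ`; the usual regret
bound and Jensen's inequality apply.

*Optimality of posted prices.* Her externalities do not enter the utility of buyer `i`, so under
incentive compatibility her interim utility is a convex function of her value, and its derivative
`q_i` is her interim allocation for almost every type. Individual rationality bounds her utility at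
the lowest value from below by minus the expected externalities that she may suffer. Integration by
parts turns the revenue into a linear functional of the monotone functions `q_i` with values in
`[0, 1]`. Such functions are averages of indicators of upper intervals, which correspond to
thresholds.
-/

namespace DataMarket

open Set

/-! ### Supergradients of concave functions -/

/-- `ψ x` is a supergradient of `R` relative to `s` at every point `x` of `s`. Convexity of `u`
with subgradients `q` is expressed as `IsSupergradientOn (-q) (-u) s`. -/
def IsSupergradientOn (ψ R : ℝ → ℝ) (s : Set ℝ) : Prop :=
  ∀ ⦃x⦄, x ∈ s → ∀ ⦃y⦄, y ∈ s → R y - R x ≤ ψ x * (y - x)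

namespace IsSupergradientOn

variable {R ψ : ℝ → ℝ} {s : Set ℝ} {a b x : ℝ}

theorem of_antitoneOn_of_integral_eq (hψ : AntitoneOn ψ (Icc a b))
    (hR : ∀ x ∈ Icc a b, ∀ y ∈ Icc a b, ∫ v in x..y, ψ v = R y - R x) :
    IsSupergradientOn ψ R (Icc a b) := by
  intro x hx y hy
  have hsub : uIcc x y ⊆ Icc a b := uIcc_subset_Icc hx hy
  have hint : IntervalIntegrable ψ volume x y := (hψ.mono hsub).intervalIntegrable
  rw [← hR x hx y hy]
  rcases le_total x y with hxy | hyx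
  · have := intervalIntegral.integral_mono_on hxy hint (intervalIntegrable_const (c := ψ x))
      fun v hv => hψ hx (hsub (by rwa [uIcc_of_le hxy])) hv.1
    simpa [mul_comm] using this
  · have := intervalIntegral.integral_mono_on hyx (intervalIntegrable_const (c := ψ x)) hint.symm
      fun v hv => hψ (hsub (by rwa [uIcc_of_ge hyx])) hx hv.2
    rw [intervalIntegral.integral_symm]
    simp only [intervalIntegral.integral_const, smul_eq_mul] at this
    linarith

theorem antitoneOn (h : IsSupergradientOn ψ R s) : AntitoneOn ψ s := by
  intro x hx y hy hxy
  rcases hxy.eq_or_lt with rfl | hlt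
  · rfl
  · nlinarith [h hx hy, h hy hx]

theorem concaveOn (h : IsSupergradientOn ψ R s) (hs : Convex ℝ s) : ConcaveOn ℝ s R := by
  refine ⟨hs, fun x hx y hy p r hp hr hpr => ?_⟩
  have hz := hs hx hy hp hr hpr
  have hzx := mul_le_mul_of_nonneg_left (h hz hx) hp
  have hzy := mul_le_mul_of_nonneg_left (h hz hy) hr
  obtain rfl : r = 1 - p := by linarith
  simp only [smul_eq_mul] at *
  nlinarith

theorem comp_add_mul (h : IsSupergradientOn ψ R s) {t : Set ℝ} {c δ : ℝ}
    (hmaps : MapsTo (fun x => c + δ * x) t s) :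
    IsSupergradientOn (fun x => δ * ψ (c + δ * x)) (fun x => R (c + δ * x)) t := by
  intro x hx y hy
  have := h (hmaps hx) (hmaps hy)
  linarith

theorem lipschitzOnWith (h : IsSupergradientOn ψ R (Icc a b)) :
    LipschitzOnWith (max |ψ a| |ψ b|).toNNReal R (Icc a b) := by
  refine LipschitzOnWith.of_le_add_mul _ fun x hx y hy => ?_
  have hab := hx.1.trans hx.2
  have hψy : |ψ y| ≤ max |ψ a| |ψ b| := by
    rw [max_comm]
    exact abs_le_max_abs_abs (h.antitoneOn hy (right_mem_Icc.2 hab) hy.2)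
      (h.antitoneOn (left_mem_Icc.2 hab) hy hy.1)
  rw [Real.coe_toNNReal _ (by positivity), Real.dist_eq]
  calc R x ≤ R y + ψ y * (x - y) := by linarith [h hy hx]
    _ ≤ R y + |ψ y| * |x - y| := by rw [← abs_mul]; gcongr; exact le_abs_self _
    _ ≤ R y + max |ψ a| |ψ b| * |x - y| := by gcongr

theorem continuousOn (h : IsSupergradientOn ψ R (Icc a b)) : ContinuousOn R (Icc a b) :=
  h.lipschitzOnWith.continuousOn

theorem hasDerivAt (h : IsSupergradientOn ψ R s) (hs : s ∈ nhds x) (hψ : ContinuousAt ψ x) :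
    HasDerivAt R (ψ x) x := by
  rw [hasDerivAt_iff_isLittleO, Asymptotics.isLittleO_iff]
  intro ε hε
  filter_upwards [hs, Metric.continuousAt_iff'.1 hψ ε hε] with y hy hyε
  rw [Real.dist_eq] at hyε
  have hxy := h (mem_of_mem_nhds hs) hy
  have hyx := h hy (mem_of_mem_nhds hs)
  rw [smul_eq_mul, Real.norm_eq_abs, Real.norm_eq_abs, abs_of_nonpos (by linarith)]
  calc -(R y - R x - (y - x) * ψ x) ≤ -(ψ y - ψ x) * (y - x) := by linarith
    _ ≤ |ψ y - ψ x| * |y - x| := by rw [← abs_neg (ψ y - ψ x), ← abs_mul]; exact le_abs_self _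
    _ ≤ ε * |y - x| := by gcongr

theorem eq_of_forall_sub_le (h : IsSupergradientOn ψ R s) (hs : s ∈ nhds x)
    (hψ : ContinuousAt ψ x) {p : ℝ} (hp : ∀ y ∈ s, R y - R x ≤ p * (y - x)) : p = ψ x := by
  have hmax : IsLocalMax (fun y => R y - p * y) x := by
    filter_upwards [hs] with y hy
    linarith [hp y hy]
  have hderiv := hmax.hasDerivAt_eq_zero ((h.hasDerivAt hs hψ).sub ((hasDerivAt_id x).const_mul p))
  linarith

theorem countable_not_continuousAt (h : IsSupergradientOn ψ R (Icc a b)) :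
    {x ∈ Ioo a b | ¬ContinuousAt ψ x}.Countable :=
  have hsub : {x ∈ Ioo a b | ¬ContinuousAt ψ x} ⊆
      {x ∈ Icc a b | ¬ContinuousWithinAt ψ (Icc a b) x} := fun _ hx =>
    ⟨Ioo_subset_Icc_self hx.1, fun hc => hx.2 (hc.continuousAt (Icc_mem_nhds hx.1.1 hx.1.2))⟩
  h.antitoneOn.countable_not_continuousWithinAt.mono hsub

theorem ae_continuousAt (h : IsSupergradientOn ψ R (Icc a b)) (μ : Measure ℝ)
    [NullSingletonClass μ] : ∀ᵐ x ∂μ, x ∈ Icc a b → Icc a b ∈ nhds x ∧ ContinuousAt ψ x := by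
  have hae : ∀ᵐ x ∂μ, x ∉ {x ∈ Ioo a b | ¬ContinuousAt ψ x} ∪ {a, b} :=
    (h.countable_not_continuousAt.union (to_countable {a, b})).ae_notMem μ
  filter_upwards [hae] with x hx hxI
  simp only [mem_union, mem_insert_iff, mem_singleton_iff, not_or] at hx
  have hxo : x ∈ Ioo a b := ⟨hxI.1.lt_of_ne' hx.2.1, hxI.2.lt_of_ne hx.2.2⟩
  exact ⟨Icc_mem_nhds hxo.1 hxo.2, by_contra fun hc => hx.1 ⟨hxo, hc⟩⟩

theorem intervalIntegrable (h : IsSupergradientOn ψ R (Icc a b)) (hx : x ∈ Icc a b) {y : ℝ}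
    (hy : y ∈ Icc a b) : IntervalIntegrable ψ volume x y :=
  (h.antitoneOn.mono (uIcc_subset_Icc hx hy)).intervalIntegrable

theorem integral_deriv_mul_add_mul (h : IsSupergradientOn ψ R (Icc a b)) {F F' : ℝ → ℝ}
    (hF : ∀ x ∈ Icc a b, HasDerivAt F (F' x) x) (hF' : ContinuousOn F' (Icc a b))
    {y : ℝ} (hx : x ∈ Icc a b) (hy : y ∈ Icc a b) :
    ∫ v in x..y, (F' v * R v + F v * ψ v) = F y * R y - F x * R x := by
  have hsub : uIcc x y ⊆ Icc a b := uIcc_subset_Icc hx hy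
  have hFc : ContinuousOn F (Icc a b) := fun v hv => (hF v hv).continuousAt.continuousWithinAt
  refine integral_eq_of_hasDerivAt_off_countable _ _ h.countable_not_continuousAt
    ((hFc.mul h.continuousOn).mono hsub) ?_
    (((hF'.mul h.continuousOn).mono hsub).intervalIntegrable.add
      ((h.intervalIntegrable hx hy).continuousOn_mul (hFc.mono hsub)))
  rintro v ⟨hv, hvc⟩
  have hvI : v ∈ Ioo a b :=
    ⟨(le_min hx.1 hy.1).trans_lt hv.1, hv.2.trans_le (max_le hx.2 hy.2)⟩
  exact (hF v (Ioo_subset_Icc_self hvI)).mul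
    (h.hasDerivAt (Icc_mem_nhds hvI.1 hvI.2) (by_contra fun hc => hvc ⟨hvI, hc⟩))

theorem integral_eq (h : IsSupergradientOn ψ R (Icc a b)) {y : ℝ} (hx : x ∈ Icc a b)
    (hy : y ∈ Icc a b) : ∫ v in x..y, ψ v = R y - R x := by
  simpa using h.integral_deriv_mul_add_mul (F := fun _ => 1) (F' := fun _ => 0)
    (fun _ _ => hasDerivAt_const _ _) continuousOn_const hx hy

end IsSupergradientOn

/-! ### One-point gradient estimates -/

/-- The average of `R (τ + δ x)` over `x ∈ [-1, 1]` with density `3 / 4 * (1 - x ^ 2)`. -/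
noncomputable def parabolicSmoothing (R : ℝ → ℝ) (δ τ : ℝ) : ℝ :=
  3 / 4 * ∫ x in (-1 : ℝ)..1, (1 - x ^ 2) * R (τ + δ * x)

/-- The mean of the one-point gradient estimate `R (τ + δ u) * u / δ`, where `u` is uniform on
`[-1, 1]`. -/
noncomputable def onePointGradient (R : ℝ → ℝ) (δ τ : ℝ) : ℝ :=
  1 / 2 * ∫ u in (-1 : ℝ)..1, R (τ + δ * u) * u / δ

theorem integral_one_sub_sq_mul_affine (r l : ℝ) :
    ∫ x in (-1 : ℝ)..1, (1 - x ^ 2) * (r + l * x) = 4 / 3 * r := by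
  have hexpand : (fun x : ℝ => (1 - x ^ 2) * (r + l * x)) =
      fun x => r - r * x ^ 2 + l * x ^ 1 - l * x ^ 3 := by ext; ring
  rw [hexpand, intervalIntegral.integral_sub, intervalIntegral.integral_add,
    intervalIntegral.integral_sub]
  · simp only [intervalIntegral.integral_const_mul, integral_pow,
      intervalIntegral.integral_const, smul_eq_mul]
    norm_num
    ring
  all_goals exact Continuous.intervalIntegrable (by fun_prop) _ _

section Smoothing

variable {R ψ : ℝ → ℝ} {a b δ τ : ℝ}

theorem mapsTo_add_mul_Icc (hδ : 0 ≤ δ) (hτ : τ ∈ Icc (a + δ) (b - δ)) :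
    MapsTo (fun x => τ + δ * x) (Icc (-1) 1) (Icc a b) := by
  intro x hx
  constructor <;> nlinarith [hx.1, hx.2, hτ.1, hτ.2]

theorem intervalIntegrable_one_sub_sq_mul (hR : ContinuousOn R (Icc a b)) (hδ : 0 ≤ δ)
    (hτ : τ ∈ Icc (a + δ) (b - δ)) :
    IntervalIntegrable (fun x => (1 - x ^ 2) * R (τ + δ * x)) volume (-1) 1 := by
  refine ContinuousOn.intervalIntegrable ?_
  rw [uIcc_of_le (by norm_num)]
  exact ContinuousOn.mul (by fun_prop) (hR.comp (by fun_prop) (mapsTo_add_mul_Icc hδ hτ))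

theorem one_sub_sq_nonneg {x : ℝ} (hx : x ∈ Icc (-1 : ℝ) 1) : 0 ≤ 1 - x ^ 2 := by
  nlinarith [hx.1, hx.2]

theorem le_parabolicSmoothing (hR : ContinuousOn R (Icc a b)) (hδ : 0 ≤ δ)
    (hτ : τ ∈ Icc (a + δ) (b - δ)) {c : ℝ} (hc : ∀ x ∈ Icc (-1 : ℝ) 1, c ≤ R (τ + δ * x)) :
    c ≤ parabolicSmoothing R δ τ := by
  have hmono : ∫ x in (-1 : ℝ)..1, (1 - x ^ 2) * (c + 0 * x) ≤
      ∫ x in (-1 : ℝ)..1, (1 - x ^ 2) * R (τ + δ * x) :=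
    intervalIntegral.integral_mono_on (by norm_num)
      (Continuous.intervalIntegrable (by fun_prop) _ _)
      (intervalIntegrable_one_sub_sq_mul hR hδ hτ) fun x hx =>
        mul_le_mul_of_nonneg_left (by linarith [hc x hx]) (one_sub_sq_nonneg hx)
  rw [integral_one_sub_sq_mul_affine] at hmono
  rw [parabolicSmoothing]
  linarith

namespace IsSupergradientOn

theorem parabolicSmoothing_le (h : IsSupergradientOn ψ R (Icc a b)) (hδ : 0 ≤ δ)
    (hτ : τ ∈ Icc (a + δ) (b - δ)) : parabolicSmoothing R δ τ ≤ R τ := by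
  have hτ' : τ ∈ Icc a b := by simpa using mapsTo_add_mul_Icc hδ hτ (x := 0) (by simp)
  have hmono : ∫ x in (-1 : ℝ)..1, (1 - x ^ 2) * R (τ + δ * x) ≤
      ∫ x in (-1 : ℝ)..1, (1 - x ^ 2) * (R τ + ψ τ * δ * x) :=
    intervalIntegral.integral_mono_on (by norm_num)
      (intervalIntegrable_one_sub_sq_mul h.continuousOn hδ hτ)
      (Continuous.intervalIntegrable (by fun_prop) _ _) fun x hx =>
        mul_le_mul_of_nonneg_left (by linarith [h hτ' (mapsTo_add_mul_Icc hδ hτ hx)])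
          (one_sub_sq_nonneg hx)
  rw [integral_one_sub_sq_mul_affine] at hmono
  rw [parabolicSmoothing]
  linarith

theorem integral_one_sub_sq_mul_eq_onePointGradient (h : IsSupergradientOn ψ R (Icc a b))
    (hδ : 0 < δ) (hτ : τ ∈ Icc (a + δ) (b - δ)) :
    ∫ x in (-1 : ℝ)..1, (1 - x ^ 2) * (δ * ψ (τ + δ * x)) = δ * (4 * onePointGradient R δ τ) := by
  have hmaps := mapsTo_add_mul_Icc hδ.le hτ
  have hcomp := h.comp_add_mul hmaps
  have hneg : (-1 : ℝ) ∈ Icc (-1 : ℝ) 1 := by simp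
  have hone : (1 : ℝ) ∈ Icc (-1 : ℝ) 1 := by simp
  have hparts := hcomp.integral_deriv_mul_add_mul (F := fun x => 1 - x ^ 2)
    (F' := fun x => -(2 * x)) (fun x _ => by simpa using (hasDerivAt_pow 2 x).const_sub 1)
    (by fun_prop) hneg hone
  have hint : IntervalIntegrable (fun x => -(2 * x) * R (τ + δ * x)) volume (-1) 1 := by
    refine ContinuousOn.intervalIntegrable ?_
    rw [uIcc_of_le (by norm_num)]
    exact ContinuousOn.mul (by fun_prop) hcomp.continuousOn
  have hgrad : ∫ x in (-1 : ℝ)..1, -(2 * x) * R (τ + δ * x) =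
      -(δ * (4 * onePointGradient R δ τ)) := by
    have hscale : (fun x => -(2 * x) * R (τ + δ * x)) =
        fun x => -2 * δ * (R (τ + δ * x) * x / δ) := by
      ext x
      field_simp
    rw [hscale, intervalIntegral.integral_const_mul, onePointGradient]
    ring
  rw [intervalIntegral.integral_add hint
    ((hcomp.intervalIntegrable hneg hone).continuousOn_mul (by fun_prop)), hgrad] at hparts
  linarith

theorem parabolicSmoothing (h : IsSupergradientOn ψ R (Icc a b)) (hδ : 0 < δ) :
    IsSupergradientOn (fun τ => 3 * onePointGradient R δ τ) (parabolicSmoothing R δ)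
      (Icc (a + δ) (b - δ)) := by
  intro τ hτ σ hσ
  have hintσ := intervalIntegrable_one_sub_sq_mul h.continuousOn hδ.le hσ
  have hintτ := intervalIntegrable_one_sub_sq_mul h.continuousOn hδ.le hτ
  have hintψ : IntervalIntegrable (fun x => (1 - x ^ 2) * (δ * ψ (τ + δ * x))) volume (-1) 1 :=
    ((h.comp_add_mul (mapsTo_add_mul_Icc hδ.le hτ)).intervalIntegrable (by simp)
      (by simp)).continuousOn_mul (by fun_prop)
  have hmono : ∫ x in (-1 : ℝ)..1, ((1 - x ^ 2) * R (σ + δ * x) - (1 - x ^ 2) * R (τ + δ * x)) ≤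
      ∫ x in (-1 : ℝ)..1, (σ - τ) / δ * ((1 - x ^ 2) * (δ * ψ (τ + δ * x))) := by
    refine intervalIntegral.integral_mono_on (by norm_num) (hintσ.sub hintτ)
      (hintψ.const_mul _) fun x hx => ?_
    have hsuper := mul_le_mul_of_nonneg_left
      (h (mapsTo_add_mul_Icc hδ.le hτ hx) (mapsTo_add_mul_Icc hδ.le hσ hx)) (one_sub_sq_nonneg hx)
    have hcancel : (σ - τ) / δ * ((1 - x ^ 2) * (δ * ψ (τ + δ * x))) =
        (1 - x ^ 2) * (ψ (τ + δ * x) * (σ + δ * x - (τ + δ * x))) := by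
      field_simp
      ring
    linarith
  rw [intervalIntegral.integral_sub hintσ hintτ, intervalIntegral.integral_const_mul,
    h.integral_one_sub_sq_mul_eq_onePointGradient hδ hτ] at hmono
  have hcancel : (σ - τ) / δ * (δ * (4 * onePointGradient R δ τ)) =
      4 * onePointGradient R δ τ * (σ - τ) := by
    field_simp
  simp only [DataMarket.parabolicSmoothing]
  linarith

end IsSupergradientOn

/-- The witness moves `σ` towards the midpoint of `[a, b]`, just enough for its `δ`-neighbourhood
to lie in the interval. -/
theorem exists_mem_Icc_forall_sub_le {B σ : ℝ} (hR : ConcaveOn ℝ (Icc a b) R)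
    (hR0 : ∀ x ∈ Icc a b, 0 ≤ R x) (hRB : R σ ≤ B) (hδ : 0 < δ) (hδab : 2 * δ ≤ b - a)
    (hσ : σ ∈ Icc a b) :
    ∃ s ∈ Icc (a + δ) (b - δ), ∀ x ∈ Icc (-1 : ℝ) 1,
      R σ - 2 * δ / (b - a) * B ≤ R (s + δ * x) := by
  have hba : 0 < b - a := by linarith
  set l := 2 * δ / (b - a) with hl
  have hl0 : 0 < l := by positivity
  have hl1 : l ≤ 1 := (div_le_one hba).2 hδab
  have hδl : δ = l * ((b - a) / 2) := by rw [hl]; field_simp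
  refine ⟨(1 - l) * σ + l * ((a + b) / 2), ⟨?_, ?_⟩, fun x hx => ?_⟩
  · nlinarith [mul_le_mul_of_nonneg_left hσ.1 (sub_nonneg.2 hl1)]
  · nlinarith [mul_le_mul_of_nonneg_left hσ.2 (sub_nonneg.2 hl1)]
  have hmid : (a + b) / 2 + (b - a) / 2 * x ∈ Icc a b := by
    constructor <;> nlinarith [hx.1, hx.2]
  have hconc := hR.2 hσ hmid (sub_nonneg.2 hl1) hl0.le (by ring)
  simp only [smul_eq_mul] at hconc
  have hpoint : (1 - l) * σ + l * ((a + b) / 2) + δ * x =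
      (1 - l) * σ + l * ((a + b) / 2 + (b - a) / 2 * x) := by
    linear_combination x * hδl
  rw [hpoint]
  nlinarith [mul_nonneg hl0.le (hR0 _ hmid), mul_le_mul_of_nonneg_left hRB hl0.le]

theorem IsSupergradientOn.exists_regret_le_onePointGradient (h : IsSupergradientOn ψ R (Icc a b))
    {B σ : ℝ} (hR0 : ∀ x ∈ Icc a b, 0 ≤ R x) (hRB : R σ ≤ B) (hδ : 0 < δ)
    (hδab : 2 * δ ≤ b - a) (hσ : σ ∈ Icc a b) :
    ∃ s ∈ Icc (a + δ) (b - δ), ∀ τ ∈ Icc (a + δ) (b - δ),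
      R σ - 2 * δ / (b - a) * B - R τ ≤ 3 * onePointGradient R δ τ * (s - τ) := by
  obtain ⟨s, hs, hle⟩ :=
    exists_mem_Icc_forall_sub_le (h.concaveOn (convex_Icc a b)) hR0 hRB hδ hδab hσ
  refine ⟨s, hs, fun τ hτ => ?_⟩
  linarith [h.parabolicSmoothing hδ hτ hs, h.parabolicSmoothing_le hδ.le hτ,
    le_parabolicSmoothing h.continuousOn hδ.le hs hle]

end Smoothing

/-! ### Projected stochastic gradient ascent -/

section Recursion

variable {Ω α β : Type*} [MeasurableSpace α] [MeasurableSpace β]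
  {W : ℕ → Ω → α} {T : ℕ → Ω → β} {step : β × α → β} {x₀ : β}

theorem exists_measurable_comp_of_recursion (hstep : Measurable step) (hT0 : ∀ ω, T 0 ω = x₀)
    (hTs : ∀ k ω, T (k + 1) ω = step (T k ω, W k ω)) (k : ℕ) :
    ∃ φ : (Finset.range k → α) → β, Measurable φ ∧ ∀ ω, T k ω = φ fun j => W j ω := by
  induction k with
  | zero => exact ⟨fun _ => x₀, measurable_const, hT0⟩
  | succ k ih =>
    obtain ⟨φ, hφ, hTφ⟩ := ih
    refine ⟨fun x => step (φ fun j => x ⟨j, Finset.range_mono k.le_succ j.2⟩,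
      x ⟨k, Finset.self_mem_range_succ k⟩), ?_, fun ω => ?_⟩
    · exact hstep.comp ((hφ.comp (measurable_pi_lambda _ fun j => measurable_pi_apply _)).prodMk
        (measurable_pi_apply _))
    · rw [hTs, hTφ]

variable [MeasurableSpace Ω] {P : Measure Ω}

theorem measurable_of_recursion (hstep : Measurable step) (hW : ∀ k, Measurable (W k))
    (hT0 : ∀ ω, T 0 ω = x₀) (hTs : ∀ k ω, T (k + 1) ω = step (T k ω, W k ω)) (k : ℕ) :
    Measurable (T k) := by
  obtain ⟨φ, hφ, hTφ⟩ := exists_measurable_comp_of_recursion hstep hT0 hTs k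
  rw [funext hTφ]
  exact hφ.comp (measurable_pi_lambda _ fun j => hW j)

theorem indepFun_of_recursion (hstep : Measurable step) (hW : ∀ k, Measurable (W k))
    (hind : iIndepFun W P) (hT0 : ∀ ω, T 0 ω = x₀)
    (hTs : ∀ k ω, T (k + 1) ω = step (T k ω, W k ω)) (k : ℕ) : IndepFun (T k) (W k) P := by
  obtain ⟨φ, hφ, hTφ⟩ := exists_measurable_comp_of_recursion hstep hT0 hTs k
  rw [funext hTφ]
  exact (hind.indepFun_finset (Finset.range k) {k} (by simp) hW).comp hφ
    (measurable_pi_apply (⟨k, Finset.mem_singleton_self k⟩ : ({k} : Finset ℕ)))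

theorem map_prodMk_eq_prod_of_indepFun [IsFiniteMeasure P] {X : Ω → β} {Y : Ω → α}
    {ν : Measure α} (hX : Measurable X) (hY : Measurable Y) (hXY : IndepFun X Y P)
    (hν : P.map Y = ν) : P.map (fun ω => (X ω, Y ω)) = (P.map X).prod ν := by
  rw [(indepFun_iff_map_prod_eq_prod_map_map hX.aemeasurable hY.aemeasurable).1 hXY, hν]

theorem integrable_integral_of_indepFun [IsProbabilityMeasure P] {X : Ω → β} {Y : Ω → α}
    {ν : Measure α} (hX : Measurable X) (hY : Measurable Y) (hXY : IndepFun X Y P)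
    (hν : P.map Y = ν) {g : β × α → ℝ} (hg : Measurable g)
    (hgi : Integrable (fun ω => g (X ω, Y ω)) P) :
    Integrable (fun ω => ∫ y, g (X ω, y) ∂ν) P ∧
      ∫ ω, ∫ y, g (X ω, y) ∂ν ∂P = ∫ ω, g (X ω, Y ω) ∂P := by
  have : IsProbabilityMeasure ν := hν ▸ Measure.isProbabilityMeasure_map hY.aemeasurable
  have hXY' : AEMeasurable (fun ω => (X ω, Y ω)) P := (hX.prodMk hY).aemeasurable
  have hmap := map_prodMk_eq_prod_of_indepFun hX hY hXY hν
  have hint : Integrable g ((P.map X).prod ν) := by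
    rw [← hmap]
    exact (integrable_map_measure hg.aestronglyMeasurable hXY').2 hgi
  have hleft := hint.integral_prod_left
  refine ⟨(integrable_map_measure hleft.aestronglyMeasurable hX.aemeasurable).1 hleft, ?_⟩
  rw [← integral_map hX.aemeasurable hleft.aestronglyMeasurable, ← integral_prod _ hint, ← hmap,
    integral_map hXY' hg.aestronglyMeasurable]

end Recursion

/-- One step of gradient ascent on `[a, b]` with step size `γ`: from the point `z.1`, with the
gradient estimated as `g z` from the sample `z.2`, and followed by the projection to `[a, b]`. -/
noncomputable def gradStep {α : Type*} (g : ℝ × α → ℝ) (a b γ : ℝ) (z : ℝ × α) : ℝ :=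
  max a (min b (z.1 + γ * g z))

section GradStep

variable {α : Type*} {g : ℝ × α → ℝ} {a b γ s : ℝ}

theorem gradStep_mem_Icc (hab : a ≤ b) (z : ℝ × α) : gradStep g a b γ z ∈ Icc a b :=
  ⟨le_max_left _ _, max_le hab (min_le_left _ _)⟩

theorem sq_gradStep_sub_le (hs : s ∈ Icc a b) (z : ℝ × α) :
    (gradStep g a b γ z - s) ^ 2 ≤
      (z.1 - s) ^ 2 - 2 * γ * ((s - z.1) * g z) + γ ^ 2 * g z ^ 2 := by
  have hab := hs.1.trans hs.2
  have hproj : |gradStep g a b γ z - s| ≤ |z.1 + γ * g z - s| := by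
    have := abs_projIcc_sub_projIcc hab (c := z.1 + γ * g z) (d := s)
    rwa [projIcc_of_mem hab hs, coe_projIcc] at this
  calc (gradStep g a b γ z - s) ^ 2 ≤ (z.1 + γ * g z - s) ^ 2 := sq_le_sq.2 hproj
    _ = (z.1 - s) ^ 2 - 2 * γ * ((s - z.1) * g z) + γ ^ 2 * g z ^ 2 := by ring

variable [MeasurableSpace α]

theorem measurable_gradStep (hg : Measurable g) : Measurable (gradStep g a b γ) := by
  unfold gradStep
  fun_prop

variable {Ω : Type*} [MeasurableSpace Ω] {P : Measure Ω} [IsProbabilityMeasure P] {ν : Measure α}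
  {G : ℝ} {ρ : ℝ → ℝ}

theorem integrable_sq_sub_of_mem_Icc {X : Ω → ℝ} (hX : Measurable X) (hmem : ∀ ω, X ω ∈ Icc a b)
    (hs : s ∈ Icc a b) : Integrable (fun ω => (X ω - s) ^ 2) P := by
  refine Integrable.of_mem_Icc 0 ((b - a) ^ 2) (by fun_prop) (.of_forall fun ω => ⟨sq_nonneg _, ?_⟩)
  exact sq_le_sq' (by linarith [(hmem ω).1, hs.2]) (by linarith [(hmem ω).2, hs.1])

theorem integrable_sub_mul_of_mem_Icc {X : Ω → ℝ} {Y : Ω → α} (hX : Measurable X)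
    (hY : Measurable Y) (hmem : ∀ ω, X ω ∈ Icc a b) (hs : s ∈ Icc a b) (hg : Measurable g)
    (hG : ∀ᵐ ω ∂P, |g (X ω, Y ω)| ≤ G) :
    Integrable (fun ω => (s - X ω) * g (X ω, Y ω)) P := by
  refine Integrable.of_bound (C := (b - a) * G)
    ((hX.const_sub s).mul (hg.comp (hX.prodMk hY))).aestronglyMeasurable ?_
  filter_upwards [hG] with ω hω
  obtain ⟨haX, hXb⟩ := hmem ω
  rw [norm_mul, Real.norm_eq_abs, Real.norm_eq_abs]
  exact mul_le_mul (abs_le.2 ⟨by linarith [hs.1], by linarith [hs.2]⟩) hω (abs_nonneg _)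
    (by linarith)

theorem integral_le_integral_sub_mul {X : Ω → ℝ} {Y : Ω → α} (hX : Measurable X)
    (hY : Measurable Y) (hXY : IndepFun X Y P) (hν : P.map Y = ν) (hmem : ∀ ω, X ω ∈ Icc a b)
    (hg : Measurable g) (hgi : Integrable (fun ω => (s - X ω) * g (X ω, Y ω)) P)
    (hρ : ∀ x ∈ Icc a b, ρ x ≤ (∫ y, g (x, y) ∂ν) * (s - x))
    (hρi : Integrable (fun ω => ρ (X ω)) P) :
    ∫ ω, ρ (X ω) ∂P ≤ ∫ ω, (s - X ω) * g (X ω, Y ω) ∂P := by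
  obtain ⟨hmean, hmean_eq⟩ := integrable_integral_of_indepFun hX hY hXY hν
    (g := fun z => (s - z.1) * g z) (by fun_prop) hgi
  rw [← hmean_eq]
  refine integral_mono hρi hmean fun ω => ?_
  simp only [integral_const_mul]
  linarith [hρ _ (hmem ω)]

theorem integral_sq_gradStep_sub_le {X : Ω → ℝ} {Y : Ω → α} (hX : Measurable X)
    (hY : Measurable Y) (hmem : ∀ ω, X ω ∈ Icc a b) (hs : s ∈ Icc a b) (hg : Measurable g)
    (hG : ∀ᵐ ω ∂P, |g (X ω, Y ω)| ≤ G) :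
    ∫ ω, (gradStep g a b γ (X ω, Y ω) - s) ^ 2 ∂P ≤ ∫ ω, (X ω - s) ^ 2 ∂P -
      2 * γ * ∫ ω, (s - X ω) * g (X ω, Y ω) ∂P + γ ^ 2 * G ^ 2 := by
  have hsq := integrable_sq_sub_of_mem_Icc (P := P) hX hmem hs
  have hlin := (integrable_sub_mul_of_mem_Icc hX hY hmem hs hg hG).const_mul (2 * γ)
  have hsub : Integrable
      (fun ω => (X ω - s) ^ 2 - 2 * γ * ((s - X ω) * g (X ω, Y ω))) P := hsq.sub hlin
  have hmono : ∫ ω, (gradStep g a b γ (X ω, Y ω) - s) ^ 2 ∂P ≤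
      ∫ ω, ((X ω - s) ^ 2 - 2 * γ * ((s - X ω) * g (X ω, Y ω)) + γ ^ 2 * G ^ 2) ∂P := by
    refine integral_mono_ae (integrable_sq_sub_of_mem_Icc
      ((measurable_gradStep hg).comp (hX.prodMk hY))
      (fun ω => gradStep_mem_Icc (hs.1.trans hs.2) _) hs) (hsub.add (integrable_const _)) ?_
    filter_upwards [hG] with ω hω
    have hquad : g (X ω, Y ω) ^ 2 ≤ G ^ 2 :=
      sq_le_sq' (neg_le_of_abs_le hω) (le_of_abs_le hω)
    linarith [sq_gradStep_sub_le (g := g) (γ := γ) hs (X ω, Y ω),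
      mul_le_mul_of_nonneg_left hquad (sq_nonneg γ)]
  rwa [integral_add hsub (integrable_const _), integral_sub hsq hlin, integral_const_mul,
    integral_const, probReal_univ, one_smul] at hmono

theorem integral_le_of_gradStep {X : Ω → ℝ} {Y : Ω → α} (hX : Measurable X)
    (hY : Measurable Y) (hXY : IndepFun X Y P) (hν : P.map Y = ν) (hmem : ∀ ω, X ω ∈ Icc a b)
    (hs : s ∈ Icc a b) (hγ : 0 ≤ γ) (hg : Measurable g)
    (hG : ∀ᵐ y ∂ν, ∀ x ∈ Icc a b, |g (x, y)| ≤ G)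
    (hρ : ∀ x ∈ Icc a b, ρ x ≤ (∫ y, g (x, y) ∂ν) * (s - x))
    (hρi : Integrable (fun ω => ρ (X ω)) P) :
    2 * γ * ∫ ω, ρ (X ω) ∂P ≤ ∫ ω, (X ω - s) ^ 2 ∂P -
      ∫ ω, (gradStep g a b γ (X ω, Y ω) - s) ^ 2 ∂P + γ ^ 2 * G ^ 2 := by
  have hbound : ∀ᵐ ω ∂P, |g (X ω, Y ω)| ≤ G := by
    subst hν
    filter_upwards [ae_of_ae_map hY.aemeasurable hG] with ω hω using hω _ (hmem ω)
  have hlin := integral_le_integral_sub_mul hX hY hXY hν hmem hg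
    (integrable_sub_mul_of_mem_Icc hX hY hmem hs hg hbound) hρ hρi
  linarith [integral_sq_gradStep_sub_le (γ := γ) hX hY hmem hs hg hbound,
    mul_le_mul_of_nonneg_left hlin (by positivity : 0 ≤ 2 * γ)]

theorem sum_integral_le_of_gradStep {T : ℕ → Ω → ℝ} {W : ℕ → Ω → α}
    (hT : ∀ k, Measurable (T k)) (hW : ∀ k, Measurable (W k))
    (hTW : ∀ k, IndepFun (T k) (W k) P) (hν : ∀ k, P.map (W k) = ν)
    (hmem : ∀ k ω, T k ω ∈ Icc a b)
    (hstep : ∀ k ω, T (k + 1) ω = gradStep g a b γ (T k ω, W k ω))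
    (hs : s ∈ Icc a b) (hγ : 0 ≤ γ) (hg : Measurable g)
    (hG : ∀ᵐ y ∂ν, ∀ x ∈ Icc a b, |g (x, y)| ≤ G)
    (hρ : ∀ x ∈ Icc a b, ρ x ≤ (∫ y, g (x, y) ∂ν) * (s - x))
    (hρi : ∀ k, Integrable (fun ω => ρ (T k ω)) P) (m : ℕ) :
    2 * γ * ∑ k ∈ Finset.range m, ∫ ω, ρ (T k ω) ∂P ≤ (b - a) ^ 2 + m * (γ ^ 2 * G ^ 2) := by
  have htelescope : 2 * γ * ∑ k ∈ Finset.range m, ∫ ω, ρ (T k ω) ∂P ≤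
      ∫ ω, (T 0 ω - s) ^ 2 ∂P - ∫ ω, (T m ω - s) ^ 2 ∂P + m * (γ ^ 2 * G ^ 2) := by
    induction m with
    | zero => simp
    | succ m ih =>
      have hprogress := integral_le_of_gradStep (hT m) (hW m) (hTW m) (hν m) (hmem m) hs
        hγ hg hG hρ (hρi m)
      simp only [← hstep] at hprogress
      rw [Finset.sum_range_succ, mul_add]
      push_cast
      linarith
  have hlast : 0 ≤ ∫ ω, (T m ω - s) ^ 2 ∂P := integral_nonneg fun ω => sq_nonneg _
  have hfirst : ∫ ω, (T 0 ω - s) ^ 2 ∂P ≤ ∫ _, (b - a) ^ 2 ∂P := by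
    refine integral_mono (integrable_sq_sub_of_mem_Icc (hT 0) (hmem 0) hs) (integrable_const _)
      fun ω => sq_le_sq' ?_ ?_
    · linarith [(hmem 0 ω).1, hs.2]
    · linarith [(hmem 0 ω).2, hs.1]
  simp only [integral_const, probReal_univ, one_smul] at hfirst
  linarith

end GradStep

/-! ### Values, externalities and the revenue of posted prices -/

theorem absolutelyContinuousOnInterval_add_integral {f : ℝ → ℝ} {a b : ℝ} (c : ℝ)
    (hf : IntervalIntegrable f volume a b) :
    AbsolutelyContinuousOnInterval (fun x => c + ∫ v in a..x, f v) a b :=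
  ((LipschitzWith.const c).lipschitzOnWith (s := uIcc a b)).absolutelyContinuousOnInterval.add
    (hf.absolutelyContinuousOnInterval_intervalIntegral left_mem_uIcc)

theorem ae_deriv_add_integral {f : ℝ → ℝ} {a b : ℝ} (c : ℝ)
    (hf : IntervalIntegrable f volume a b) :
    ∀ᵐ x, x ∈ uIcc a b → deriv (fun x => c + ∫ v in a..x, f v) x = f x := by
  filter_upwards [hf.ae_hasDerivAt_integral] with x hx hxI
  exact ((hx hxI a left_mem_uIcc).const_add c).deriv

theorem integral_mul_add_mul_of_primitive {F f G g : ℝ → ℝ} {a b : ℝ} (hab : a ≤ b)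
    (hf : IntervalIntegrable f volume a b) (hg : IntervalIntegrable g volume a b)
    (hF : ∀ x ∈ Icc a b, F x = F a + ∫ v in a..x, f v)
    (hG : ∀ x ∈ Icc a b, G x = G a + ∫ v in a..x, g v) :
    ∫ x in a..b, (f x * G x + F x * g x) = F b * G b - F a * G a := by
  have hparts := (absolutelyContinuousOnInterval_add_integral (F a) hf).integral_deriv_mul_eq_sub
    (absolutelyContinuousOnInterval_add_integral (G a) hg)
  rw [← hF b (right_mem_Icc.2 hab), ← hG b (right_mem_Icc.2 hab),
    ← hF a (left_mem_Icc.2 hab), ← hG a (left_mem_Icc.2 hab)] at hparts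
  rw [← hparts]
  refine intervalIntegral.integral_congr_ae ?_
  filter_upwards [ae_deriv_add_integral (F a) hf, ae_deriv_add_integral (G a) hg]
    with x hFx hGx hx
  have hx' : x ∈ uIcc a b := uIoc_subset_uIcc hx
  rw [hFx hx', hGx hx', ← hF x (uIcc_of_le hab ▸ hx'), ← hG x (uIcc_of_le hab ▸ hx')]

namespace Market

variable {n : ℕ} (M : Market n) (i : Fin n)

instance isProbabilityMeasure_extLaw : IsProbabilityMeasure (M.extLaw i) := M.extLaw_prob i

instance isProbabilityMeasure_valueLaw : IsProbabilityMeasure (M.valueLaw i) := by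
  constructor
  rw [valueLaw, withDensity_apply _ MeasurableSet.univ, Measure.restrict_univ]
  exact M.density_total i

instance isProbabilityMeasure_typeLaw : IsProbabilityMeasure M.typeLaw := by
  unfold typeLaw
  infer_instance

instance nullSingletonClass_valueLaw : NullSingletonClass (M.valueLaw i) :=
  ⟨fun v => ((withDensity_absolutelyContinuous _ _).trans
    Measure.restrict_le_self.absolutelyContinuous) (measure_singleton v)⟩

theorem ae_mem_Icc_valueLaw : ∀ᵐ v ∂M.valueLaw i, v ∈ Icc (M.vlo i) (M.vhi i) :=
  (withDensity_absolutelyContinuous _ _).ae_le (ae_restrict_mem measurableSet_Icc)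

theorem vlo_mem : M.vlo i ∈ Icc (M.vlo i) (M.vhi i) := left_mem_Icc.2 (M.vlo_lt_vhi i).le

theorem vhi_mem : M.vhi i ∈ Icc (M.vlo i) (M.vhi i) := right_mem_Icc.2 (M.vlo_lt_vhi i).le

theorem integrableOn_density : IntegrableOn (M.density i) (Icc (M.vlo i) (M.vhi i)) := by
  refine ⟨(M.density_measurable i).aestronglyMeasurable, ?_⟩
  rw [hasFiniteIntegral_iff_ofReal
    ((ae_restrict_mem measurableSet_Icc).mono fun v hv => M.density_nonneg i v hv),
    M.density_total i]
  exact ENNReal.one_lt_top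

theorem intervalIntegrable_density {x y : ℝ} (hx : x ∈ Icc (M.vlo i) (M.vhi i))
    (hy : y ∈ Icc (M.vlo i) (M.vhi i)) : IntervalIntegrable (M.density i) volume x y :=
  ((M.integrableOn_density i).mono_set (uIcc_subset_Icc hx hy)).intervalIntegrable

theorem integral_valueLaw (h : ℝ → ℝ) :
    ∫ v, h v ∂M.valueLaw i = ∫ v in M.vlo i..M.vhi i, M.density i v * h v := by
  rw [valueLaw, integral_withDensity_eq_integral_toReal_smul
    (M.density_measurable i).ennreal_ofReal (by simp),
    intervalIntegral.integral_of_le (M.vlo_lt_vhi i).le, ← integral_Icc_eq_integral_Ioc]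
  refine setIntegral_congr_fun measurableSet_Icc fun v hv => ?_
  simp [ENNReal.toReal_ofReal (M.density_nonneg i v hv)]

theorem valueCDF_eq_integral {x : ℝ} (hx : x ∈ Icc (M.vlo i) (M.vhi i)) :
    M.valueCDF i x = ∫ v in M.vlo i..x, M.density i v := by
  have hsub : Icc (M.vlo i) x ⊆ Icc (M.vlo i) (M.vhi i) := Icc_subset_Icc_right hx.2
  have hinter : Iic x ∩ Icc (M.vlo i) (M.vhi i) = Icc (M.vlo i) x := by
    rw [inter_comm, ← Ici_inter_Iic, inter_assoc, Iic_inter_Iic, min_eq_right hx.2, Ici_inter_Iic]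
  have hnonneg : 0 ≤ᵐ[volume.restrict (Icc (M.vlo i) x)] M.density i :=
    (ae_restrict_mem measurableSet_Icc).mono fun v hv => M.density_nonneg i v (hsub hv)
  rw [valueCDF, measureReal_def, valueLaw, withDensity_apply _ measurableSet_Iic,
    Measure.restrict_restrict measurableSet_Iic, hinter,
    ← integral_eq_lintegral_of_nonneg_ae hnonneg (M.density_measurable i).aestronglyMeasurable,
    integral_Icc_eq_integral_Ioc, intervalIntegral.integral_of_le hx.1]

theorem valueCDF_sub_valueCDF {x y : ℝ} (hx : x ∈ Icc (M.vlo i) (M.vhi i))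
    (hy : y ∈ Icc (M.vlo i) (M.vhi i)) :
    M.valueCDF i y - M.valueCDF i x = ∫ v in x..y, M.density i v := by
  rw [M.valueCDF_eq_integral i hx, M.valueCDF_eq_integral i hy, sub_eq_iff_eq_add',
    intervalIntegral.integral_add_adjacent_intervals
      (M.intervalIntegrable_density i (M.vlo_mem i) hx) (M.intervalIntegrable_density i hx hy)]

theorem valueCDF_vlo : M.valueCDF i (M.vlo i) = 0 := by
  rw [M.valueCDF_eq_integral i (M.vlo_mem i), intervalIntegral.integral_same]

theorem valueCDF_vhi : M.valueCDF i (M.vhi i) = 1 := by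
  have htotal := M.integral_valueLaw i fun _ => 1
  simp only [integral_const, probReal_univ, smul_eq_mul, mul_one] at htotal
  rw [M.valueCDF_eq_integral i (M.vhi_mem i), ← htotal]

theorem valueCDF_nonneg (x : ℝ) : 0 ≤ M.valueCDF i x := measureReal_nonneg

theorem valueCDF_le_one (x : ℝ) : M.valueCDF i x ≤ 1 := measureReal_le_one

theorem monotone_valueCDF : Monotone (M.valueCDF i) := fun _ _ hxy =>
  measureReal_mono (Iic_subset_Iic.2 hxy)

theorem valueLaw_real_Ici (x : ℝ) : (M.valueLaw i).real (Ici x) = 1 - M.valueCDF i x := by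
  rw [valueCDF, ← probReal_compl_eq_one_sub measurableSet_Iic, compl_Iic]
  exact measureReal_congr Ioi_ae_eq_Ici.symm

theorem ae_extLaw_nonneg (j : {j : Fin n // j ≠ i}) : ∀ᵐ η ∂M.extLaw i, 0 ≤ η j :=
  (M.extLaw_range i).mono fun _ hη => (M.etalo_nonneg _ _).trans (hη j).1

theorem integrable_extLaw (j : {j : Fin n // j ≠ i}) : Integrable (fun η => η j) (M.extLaw i) :=
  Integrable.of_mem_Icc (M.etalo j i) (M.etahi j i) (measurable_pi_apply j).aemeasurable
    ((M.extLaw_range i).mono fun _ hη => hη j)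

theorem causedExt_nonneg : 0 ≤ M.causedExt i :=
  Finset.sum_nonneg fun j _ => integral_nonneg_of_ae (M.ae_extLaw_nonneg i j)

theorem causedExt_eq_sum_meanExt :
    M.causedExt i = ∑ j : {j : Fin n // j ≠ i}, M.meanExt j ⟨i, j.2.symm⟩ := rfl

theorem sum_sum_meanExt_mul (a : Fin n → ℝ) :
    ∑ i, ∑ j : {j : Fin n // j ≠ i}, M.meanExt i j * a j = ∑ j, M.causedExt j * a j := by
  simp_rw [causedExt_eq_sum_meanExt, Finset.sum_mul]
  rw [Finset.sum_sigma', Finset.sum_sigma']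
  exact Finset.sum_bij' (fun p _ => ⟨p.2, p.1, p.2.2.symm⟩) (fun p _ => ⟨p.2, p.1, p.2.2.symm⟩)
    (by simp) (by simp) (by simp) (by simp) (by simp)

theorem measurePreserving_value :
    MeasurePreserving (fun t : Profile n => (t i).1) M.typeLaw (M.valueLaw i) :=
  measurePreserving_fst.comp
    (measurePreserving_eval (fun i => (M.valueLaw i).prod (M.extLaw i)) i)

theorem measurePreserving_ext :
    MeasurePreserving (fun t : Profile n => (t i).2) M.typeLaw (M.extLaw i) :=
  measurePreserving_snd.comp
    (measurePreserving_eval (fun i => (M.valueLaw i).prod (M.extLaw i)) i)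

/-- The part of the revenue of a posted-price mechanism that depends on the threshold of
buyer `i`: the posted price if she gets the good, and otherwise the payments of the other buyers
for not suffering her externalities. -/
noncomputable def buyerRev (τ : ℝ) : ℝ := τ * (1 - M.valueCDF i τ) + M.causedExt i * M.valueCDF i τ

/-- The derivative of `buyerRev`, which is minus the function in the regularity condition. -/
noncomputable def marginalRev (v : ℝ) : ℝ :=
  -(v * M.density i v - (1 - M.valueCDF i v) - M.density i v * M.causedExt i)

theorem intervalIntegrable_marginalRev {x y : ℝ} (hx : x ∈ Icc (M.vlo i) (M.vhi i))
    (hy : y ∈ Icc (M.vlo i) (M.vhi i)) : IntervalIntegrable (M.marginalRev i) volume x y := by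
  have hdensity := M.intervalIntegrable_density i hx hy
  exact (((hdensity.continuousOn_mul continuousOn_id).sub (intervalIntegrable_const.sub
    (M.monotone_valueCDF i).intervalIntegrable)).sub (hdensity.mul_const _)).neg

theorem integral_marginalRev_of_le {x y : ℝ} (hx : x ∈ Icc (M.vlo i) (M.vhi i))
    (hy : y ∈ Icc (M.vlo i) (M.vhi i)) (hxy : x ≤ y) :
    ∫ v in x..y, M.marginalRev i v = M.buyerRev i y - M.buyerRev i x := by
  have hdensity := M.intervalIntegrable_density i hx hy
  have hparts := integral_mul_add_mul_of_primitive (F := M.valueCDF i) (f := M.density i)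
    (G := fun v => v - M.causedExt i) (g := fun _ => 1) hxy hdensity intervalIntegrable_const
    (fun v hv => by
      rw [← M.valueCDF_sub_valueCDF i hx ⟨hx.1.trans hv.1, hv.2.trans hy.2⟩]; ring)
    (fun v _ => by simp)
  have hmarginal : ∀ v, M.marginalRev i v =
      1 - (M.density i v * (v - M.causedExt i) + M.valueCDF i v * 1) := fun v => by
    rw [marginalRev]
    ring
  simp_rw [hmarginal]
  rw [intervalIntegral.integral_sub intervalIntegrable_const
    ((hdensity.mul_continuousOn (by fun_prop)).add
      ((M.monotone_valueCDF i).intervalIntegrable.mul_const 1)), hparts]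
  simp only [intervalIntegral.integral_const, smul_eq_mul, buyerRev]
  ring

theorem integral_marginalRev {x y : ℝ} (hx : x ∈ Icc (M.vlo i) (M.vhi i))
    (hy : y ∈ Icc (M.vlo i) (M.vhi i)) :
    ∫ v in x..y, M.marginalRev i v = M.buyerRev i y - M.buyerRev i x := by
  rcases le_total x y with hxy | hyx
  · exact M.integral_marginalRev_of_le i hx hy hxy
  · rw [intervalIntegral.integral_symm, M.integral_marginalRev_of_le i hy hx hyx, neg_sub]

theorem continuousOn_buyerRev : ContinuousOn (M.buyerRev i) (Icc (M.vlo i) (M.vhi i)) := by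
  have hprim := intervalIntegral.continuousOn_primitive_interval'
    (M.intervalIntegrable_marginalRev i (M.vlo_mem i) (M.vhi_mem i)) left_mem_uIcc
  rw [uIcc_of_le (M.vlo_lt_vhi i).le] at hprim
  refine (hprim.const_add (M.buyerRev i (M.vlo i))).congr fun v hv => ?_
  simp only [M.integral_marginalRev i (M.vlo_mem i) hv, add_sub_cancel]

variable {M} in
theorem Regular.isSupergradientOn_buyerRev (hM : M.Regular) :
    IsSupergradientOn (M.marginalRev i) (M.buyerRev i) (Icc (M.vlo i) (M.vhi i)) :=
  .of_antitoneOn_of_integral_eq (hM i).neg fun _ hx _ hy => M.integral_marginalRev i hx hy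

theorem buyerRev_nonneg {x : ℝ} (hx : x ∈ Icc (M.vlo i) (M.vhi i)) : 0 ≤ M.buyerRev i x :=
  add_nonneg (mul_nonneg ((M.vlo_nonneg i).trans hx.1) (sub_nonneg.2 (M.valueCDF_le_one i x)))
    (mul_nonneg (M.causedExt_nonneg i) (M.valueCDF_nonneg i x))

theorem buyerRev_le {B x : ℝ} (hxB : x ≤ B) (hc : M.causedExt i ≤ B) : M.buyerRev i x ≤ B := by
  have hprice := mul_le_mul_of_nonneg_right hxB (sub_nonneg.2 (M.valueCDF_le_one i x))
  have hext := mul_le_mul_of_nonneg_right hc (M.valueCDF_nonneg i x)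
  unfold buyerRev
  linarith

theorem measurable_buyerRev : Measurable (M.buyerRev i) := by
  have := (M.monotone_valueCDF i).measurable
  unfold buyerRev
  fun_prop

theorem integrable_indicator_value (τ : ℝ) :
    Integrable (fun t : Profile n => (Ici τ).indicator (1 : ℝ → ℝ) (t i).1) M.typeLaw :=
  (M.measurePreserving_value i).integrable_comp_of_integrable
    ((integrable_const (1 : ℝ)).indicator measurableSet_Ici)

theorem integral_indicator_value (τ : ℝ) :
    ∫ t : Profile n, (Ici τ).indicator (1 : ℝ → ℝ) (t i).1 ∂M.typeLaw = 1 - M.valueCDF i τ := by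
  rw [← M.valueLaw_real_Ici, ← integral_indicator_one measurableSet_Ici,
    ← (M.measurePreserving_value i).map_eq,
    integral_map (M.measurePreserving_value i).measurable.aemeasurable
      (measurable_one.indicator measurableSet_Ici).aestronglyMeasurable]

theorem integrable_pay_postedPrice (τ : Fin n → ℝ) :
    Integrable (fun t => (postedPrice M τ).pay (truthful t) i) M.typeLaw ∧
      ∫ t, (postedPrice M τ).pay (truthful t) i ∂M.typeLaw = τ i * (1 - M.valueCDF i (τ i)) +
        ∑ j : {j : Fin n // j ≠ i}, M.meanExt i j * M.valueCDF j (τ j) := by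
  have hpay : (fun t : Profile n => (postedPrice M τ).pay (truthful t) i) = fun t =>
      (Ici (τ i)).indicator 1 (t i).1 * τ i +
        ∑ j : {j : Fin n // j ≠ i}, M.meanExt i j * (1 - (Ici (τ j)).indicator 1 (t j).1) := by
    ext t
    simp [postedPrice, truthful, indicator]
  have hprice := (M.integrable_indicator_value i (τ i)).mul_const (τ i)
  have hext : ∀ j : {j : Fin n // j ≠ i}, Integrable (fun t : Profile n =>
      M.meanExt i j * (1 - (Ici (τ j)).indicator (1 : ℝ → ℝ) (t j).1)) M.typeLaw := fun j =>
    ((integrable_const 1).sub (M.integrable_indicator_value j (τ j))).const_mul _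
  rw [hpay]
  refine ⟨hprice.add (integrable_finsetSum _ fun j _ => hext j), ?_⟩
  rw [integral_add hprice (integrable_finsetSum _ fun j _ => hext j), integral_mul_const,
    integral_indicator_value, integral_finsetSum _ fun j _ => hext j, mul_comm]
  congr 1
  refine Finset.sum_congr rfl fun j _ => ?_
  rw [integral_const_mul, integral_sub (integrable_const 1) (M.integrable_indicator_value j (τ j)),
    integral_indicator_value, integral_const, probReal_univ, one_smul, sub_sub_cancel]

theorem rev_postedPrice (τ : Fin n → ℝ) :
    (postedPrice M τ).rev M = ∑ i, M.buyerRev i (τ i) := by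
  unfold Mechanism.rev
  rw [integral_finsetSum _ fun i _ => (M.integrable_pay_postedPrice i τ).1]
  simp_rw [(M.integrable_pay_postedPrice _ τ).2]
  rw [Finset.sum_add_distrib, M.sum_sum_meanExt_mul fun j => M.valueCDF j (τ j),
    ← Finset.sum_add_distrib]
  rfl

end Market

/-! ### The learning algorithm -/

/-- The law of the perturbation of the price of one buyer, the uniform law on `[-1, 1]`. -/
noncomputable abbrev uniformNoise : Measure ℝ := cond volume (Icc (-1 : ℝ) 1)

instance isProbabilityMeasure_uniformNoise : IsProbabilityMeasure uniformNoise :=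
  cond_isProbabilityMeasure_of_finite (by simp) (by simp)

theorem integral_uniformNoise (h : ℝ → ℝ) :
    ∫ u, h u ∂uniformNoise = 1 / 2 * ∫ u in (-1 : ℝ)..1, h u := by
  rw [uniformNoise, ProbabilityTheory.cond, integral_smul_measure,
    intervalIntegral.integral_of_le (by norm_num), integral_Icc_eq_integral_Ioc, smul_eq_mul,
    Real.volume_Icc, ENNReal.toReal_inv, ENNReal.toReal_ofReal (by norm_num)]
  norm_num

theorem ae_uniformNoise_mem_Icc : ∀ᵐ u ∂uniformNoise, u ∈ Icc (-1 : ℝ) 1 :=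
  ae_cond_mem measurableSet_Icc

namespace Market

section Estimate

variable {n : ℕ} (M : Market n) (i : Fin n)

theorem revEstimate_eq_indicator (p v : ℝ) : revEstimate M i p v =
    M.causedExt i + (Ici p).indicator 1 v * (p - M.causedExt i) := by
  by_cases h : p ≤ v <;> simp [revEstimate, indicator, h]

theorem revEstimate_mem_Icc {B p v : ℝ} (hp : 0 ≤ p) (hpB : p ≤ B) (hc : M.causedExt i ≤ B) :
    revEstimate M i p v ∈ Icc 0 B := by
  unfold revEstimate
  split_ifs
  · simpa using ⟨hp, hpB⟩
  · simpa using ⟨M.causedExt_nonneg i, hc⟩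

theorem integral_revEstimate (p : ℝ) :
    ∫ v, revEstimate M i p v ∂M.valueLaw i = M.buyerRev i p := by
  simp_rw [revEstimate_eq_indicator]
  rw [integral_add (integrable_const _)
    (((integrable_const 1).indicator measurableSet_Ici).mul_const _), integral_mul_const,
    integral_indicator_one measurableSet_Ici, valueLaw_real_Ici, integral_const, probReal_univ,
    one_smul, buyerRev]
  ring

/-- The estimate of the derivative of the revenue from buyer `i`, at the threshold `z.1`, from her
value `z.2.1` and the perturbation `z.2.2`. -/
noncomputable def gradEstimate (δ : ℝ) (z : ℝ × ℝ × ℝ) : ℝ :=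
  revEstimate M i (z.1 + δ * z.2.2) z.2.1 * z.2.2 / δ

theorem measurable_gradEstimate (δ : ℝ) : Measurable (M.gradEstimate i δ) := by
  have hdecision : Measurable fun z : ℝ × ℝ × ℝ => if z.1 + δ * z.2.2 ≤ z.2.1 then (1 : ℝ) else 0 :=
    .ite (measurableSet_le (by fun_prop) (by fun_prop)) measurable_const measurable_const
  unfold gradEstimate revEstimate
  fun_prop

variable {B δ x : ℝ}

theorem abs_gradEstimate_le (hB : M.vhi i ≤ B) (hc : M.causedExt i ≤ B) (hδ : 0 < δ)
    (hx : x ∈ Icc (M.vlo i + δ) (M.vhi i - δ)) (v : ℝ) {u : ℝ} (hu : u ∈ Icc (-1 : ℝ) 1) :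
    |M.gradEstimate i δ (x, v, u)| ≤ B / δ := by
  have hprice := mapsTo_add_mul_Icc hδ.le hx hu
  have hest := M.revEstimate_mem_Icc i (v := v) ((M.vlo_nonneg i).trans hprice.1)
    (hprice.2.trans hB) hc
  rw [gradEstimate, abs_div, abs_of_pos hδ, abs_mul, abs_of_nonneg hest.1]
  gcongr
  exact (mul_le_of_le_one_right hest.1 (abs_le.2 hu)).trans hest.2

theorem ae_abs_gradEstimate_le (hB : M.vhi i ≤ B) (hc : M.causedExt i ≤ B) (hδ : 0 < δ) :
    ∀ᵐ y ∂(M.valueLaw i).prod uniformNoise, ∀ x ∈ Icc (M.vlo i + δ) (M.vhi i - δ),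
      |M.gradEstimate i δ (x, y)| ≤ B / δ :=
  (Measure.quasiMeasurePreserving_snd.ae ae_uniformNoise_mem_Icc).mono fun y hy _ hx =>
    M.abs_gradEstimate_le i hB hc hδ hx y.1 hy

theorem integral_gradEstimate (hδ : 0 < δ) (hx : x ∈ Icc (M.vlo i + δ) (M.vhi i - δ)) :
    ∫ y, M.gradEstimate i δ (x, y) ∂(M.valueLaw i).prod uniformNoise =
      onePointGradient (M.buyerRev i) δ x := by
  have hbound := M.ae_abs_gradEstimate_le i (le_max_left _ (M.causedExt i)) (le_max_right _ _) hδ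
  have hint : Integrable (fun y => M.gradEstimate i δ (x, y))
      ((M.valueLaw i).prod uniformNoise) := by
    have hmeas := (M.measurable_gradEstimate i δ).comp (measurable_prodMk_left (x := x))
    exact .of_bound hmeas.aestronglyMeasurable _ (hbound.mono fun y hy => hy x hx)
  rw [integral_prod_symm _ hint, onePointGradient, ← integral_uniformNoise]
  simp only [gradEstimate, integral_div, integral_mul_const, integral_revEstimate]

variable {Ω : Type*} [MeasurableSpace Ω] {P : Measure Ω} [IsFiniteMeasure P]

theorem integrable_buyerRev_comp {X : Ω → ℝ} (hX : Measurable X)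
    (hmem : ∀ ω, X ω ∈ Icc (M.vlo i) (M.vhi i)) : Integrable (fun ω => M.buyerRev i (X ω)) P :=
  .of_mem_Icc 0 (max (M.vhi i) (M.causedExt i))
    ((M.measurable_buyerRev i).comp hX).aemeasurable <| .of_forall fun ω =>
      ⟨M.buyerRev_nonneg i (hmem ω),
        M.buyerRev_le i ((hmem ω).2.trans (le_max_left _ _)) (le_max_right _ _)⟩

end Estimate

end Market

theorem average_mem_Icc {K : ℕ} (hK : K ≠ 0) {a b : ℝ} {x : ℕ → ℝ} (hx : ∀ k, x k ∈ Icc a b) :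
    (∑ k ∈ Finset.range K, x k) / K ∈ Icc a b := by
  have h := (convex_Icc a b).sum_mem (t := Finset.range K) (w := fun _ => (K : ℝ)⁻¹) (z := x)
    (fun _ _ => by positivity) (by simp [hK]) fun k _ => hx k
  simpa only [smul_eq_mul, ← Finset.mul_sum, div_eq_inv_mul] using h

theorem average_le_map_average {K : ℕ} (hK : K ≠ 0) {R : ℝ → ℝ} {s : Set ℝ}
    (hR : ConcaveOn ℝ s R) {x : ℕ → ℝ} (hx : ∀ k, x k ∈ s) :
    (∑ k ∈ Finset.range K, R (x k)) / K ≤ R ((∑ k ∈ Finset.range K, x k) / K) := by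
  have h := hR.le_map_sum (t := Finset.range K) (w := fun _ => (K : ℝ)⁻¹) (p := x)
    (fun _ _ => by positivity) (by simp [hK]) fun k _ => hx k
  simpa only [smul_eq_mul, ← Finset.mul_sum, div_eq_inv_mul] using h

/-- Samples for the learning algorithm: in round `k` the buyers have types `t k` and their prices
are perturbed by `u k`, independently over the rounds. -/
structure Market.IsSample {n : ℕ} (M : Market n) {Ω : Type*} [MeasurableSpace Ω] (P : Measure Ω)
    (t : ℕ → Ω → Profile n) (u : ℕ → Ω → Fin n → ℝ) : Prop where
  measurable_type : ∀ k, Measurable (t k)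
  measurable_noise : ∀ k, Measurable (u k)
  iIndepFun : iIndepFun (fun k ω => (t k ω, u k ω)) P
  map_eq : ∀ k, P.map (fun ω => (t k ω, u k ω)) = M.typeLaw.prod (noiseLaw n)

/-- An upper bound for the regret of the learning algorithm per buyer. Its terms come from the
smoothing of the revenue and the margins of width `δ`, from the distance of the optimum to the
starting point, from the variance of the derivative estimates, and from the first round, whose
threshold need not respect the margins. -/
noncomputable def regretBound (w B δ γ : ℝ) (K : ℕ) : ℝ :=
  2 * δ / w * B + 3 * B ^ 2 / (2 * γ * K) + 3 * γ * B ^ 2 / (2 * δ ^ 2) + B / K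

section Regret

variable {n : ℕ} {M : Market n} {Ω : Type*} [MeasurableSpace Ω] {P : Measure Ω}
  {t : ℕ → Ω → Profile n} {u : ℕ → Ω → Fin n → ℝ} {δ γ w B : ℝ} {τ₁ : Fin n → ℝ} {i : Fin n}

theorem thresholds_succ (t : ℕ → Profile n) (u : ℕ → Fin n → ℝ) (k : ℕ) :
    thresholds M δ γ τ₁ t u (k + 1) i = gradStep (M.gradEstimate i δ) (M.vlo i + δ) (M.vhi i - δ) γ
      (thresholds M δ γ τ₁ t u k i, (t k i).1, u k i) := rfl

theorem thresholds_succ_mem_Icc (hδ : 2 * δ ≤ M.vhi i - M.vlo i) (t : ℕ → Profile n)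
    (u : ℕ → Fin n → ℝ) (k : ℕ) :
    thresholds M δ γ τ₁ t u (k + 1) i ∈ Icc (M.vlo i + δ) (M.vhi i - δ) := by
  rw [thresholds_succ]
  exact gradStep_mem_Icc (by linarith) _

theorem thresholds_mem_Icc (hδ : 0 ≤ δ) (hδw : 2 * δ ≤ M.vhi i - M.vlo i)
    (hτ₁ : τ₁ i ∈ Icc (M.vlo i) (M.vhi i)) (t : ℕ → Profile n) (u : ℕ → Fin n → ℝ) :
    ∀ k, thresholds M δ γ τ₁ t u k i ∈ Icc (M.vlo i) (M.vhi i)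
  | 0 => hτ₁
  | k + 1 => Icc_subset_Icc (by linarith) (by linarith) (thresholds_succ_mem_Icc hδw t u k)

namespace Market.IsSample

theorem measurable_round (h : M.IsSample P t u) (i : Fin n) (k : ℕ) :
    Measurable fun ω => ((t k ω i).1, u k ω i) := by
  have := h.measurable_type k
  have := h.measurable_noise k
  fun_prop

theorem iIndepFun_round (h : M.IsSample P t u) (i : Fin n) :
    ProbabilityTheory.iIndepFun (fun k ω => ((t k ω i).1, u k ω i)) P :=
  h.iIndepFun.comp (fun _ z => ((z.1 i).1, z.2 i)) fun _ => by fun_prop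

theorem map_round (h : M.IsSample P t u) (i : Fin n) (k : ℕ) :
    P.map (fun ω => ((t k ω i).1, u k ω i)) = (M.valueLaw i).prod uniformNoise := by
  have hproj : MeasurePreserving (fun z : Profile n × (Fin n → ℝ) => ((z.1 i).1, z.2 i))
      (M.typeLaw.prod (noiseLaw n)) ((M.valueLaw i).prod uniformNoise) :=
    (M.measurePreserving_value i).prod (measurePreserving_eval (fun _ => uniformNoise) i)
  rw [← hproj.map_eq, ← h.map_eq k,
    Measure.map_map hproj.measurable ((h.measurable_type k).prodMk (h.measurable_noise k))]
  rfl

theorem measurable_thresholds (h : M.IsSample P t u) (k : ℕ) :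
    Measurable fun ω => thresholds M δ γ τ₁ (t · ω) (u · ω) k i :=
  measurable_of_recursion (measurable_gradStep (M.measurable_gradEstimate i δ))
    (h.measurable_round i) (T := fun k ω => thresholds M δ γ τ₁ (t · ω) (u · ω) k i)
    (fun _ => rfl) (fun _ _ => rfl) k

theorem indepFun_thresholds (h : M.IsSample P t u) (k : ℕ) :
    IndepFun (fun ω => thresholds M δ γ τ₁ (t · ω) (u · ω) k i)
      (fun ω => ((t k ω i).1, u k ω i)) P :=
  indepFun_of_recursion (measurable_gradStep (M.measurable_gradEstimate i δ))
    (h.measurable_round i) (h.iIndepFun_round i)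
    (T := fun k ω => thresholds M δ γ τ₁ (t · ω) (u · ω) k i) (fun _ => rfl) (fun _ _ => rfl) k

variable [IsProbabilityMeasure P]

theorem le_sum_integral_buyerRev (h : M.IsSample P t u) (hM : M.Regular) (hB : M.vhi i ≤ B)
    (hc : M.causedExt i ≤ B) (hδ : 0 < δ) (hγ : 0 < γ) (hδw : 2 * δ ≤ M.vhi i - M.vlo i)
    {σ : ℝ} (hσ : σ ∈ Icc (M.vlo i) (M.vhi i)) (m : ℕ) :
    m * (M.buyerRev i σ - 2 * δ / (M.vhi i - M.vlo i) * B) -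
        3 / (2 * γ) * (B ^ 2 + m * (γ ^ 2 * (B / δ) ^ 2)) ≤
      ∑ k ∈ Finset.range m,
        ∫ ω, M.buyerRev i (thresholds M δ γ τ₁ (t · ω) (u · ω) (k + 1) i) ∂P := by
  set T : ℕ → Ω → ℝ := fun k ω => thresholds M δ γ τ₁ (t · ω) (u · ω) (k + 1) i
  have hTmem : ∀ k ω, T k ω ∈ Icc (M.vlo i + δ) (M.vhi i - δ) := fun k ω =>
    thresholds_succ_mem_Icc hδw (t · ω) (u · ω) k
  have hint : ∀ k, Integrable (fun ω => M.buyerRev i (T k ω)) P := fun k =>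
    M.integrable_buyerRev_comp i (h.measurable_thresholds _) fun ω =>
      Icc_subset_Icc (by linarith) (by linarith) (hTmem k ω)
  obtain ⟨s, hs, hregret⟩ := (hM.isSupergradientOn_buyerRev i).exists_regret_le_onePointGradient
    (fun x hx => M.buyerRev_nonneg i hx) (M.buyerRev_le i (hσ.2.trans hB) hc) hδ hδw hσ
  set r := M.buyerRev i σ - 2 * δ / (M.vhi i - M.vlo i) * B
  have hsgd := sum_integral_le_of_gradStep (T := T) (fun k => h.measurable_thresholds (k + 1))
    (fun k => h.measurable_round i (k + 1)) (fun k => h.indepFun_thresholds (k + 1))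
    (fun k => h.map_round i (k + 1)) hTmem (fun k ω => thresholds_succ (t · ω) (u · ω) (k + 1))
    hs hγ.le (M.measurable_gradEstimate i δ) (M.ae_abs_gradEstimate_le i hB hc hδ)
    (ρ := fun x => (r - M.buyerRev i x) / 3)
    (fun x hx => by rw [M.integral_gradEstimate i hδ hx]; linarith [hregret x hx])
    (fun k => ((integrable_const r).sub (hint k)).div_const 3) m
  have hmean : ∀ k, ∫ ω, (r - M.buyerRev i (T k ω)) / 3 ∂P =
      (r - ∫ ω, M.buyerRev i (T k ω) ∂P) / 3 := fun k => by
    rw [integral_div, integral_sub (integrable_const r) (hint k), integral_const, probReal_univ,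
      one_smul]
  simp_rw [hmean] at hsgd
  rw [← Finset.sum_div, Finset.sum_sub_distrib, Finset.sum_const, Finset.card_range,
    nsmul_eq_mul] at hsgd
  have hdist : (M.vhi i - δ - (M.vlo i + δ)) ^ 2 ≤ B ^ 2 :=
    pow_le_pow_left₀ (by linarith) (by linarith [M.vlo_nonneg i]) 2
  have hscale : ∀ y : ℝ, y ≤ 3 / (2 * γ) * (2 * γ * (y / 3)) := fun y => by field_simp; rfl
  rw [sub_le_comm]
  refine (hscale _).trans (mul_le_mul_of_nonneg_left ?_ (by positivity))
  linarith

theorem integrable_buyerRev_avgThresholds (h : M.IsSample P t u) (hδ : 0 ≤ δ)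
    (hδw : 2 * δ ≤ M.vhi i - M.vlo i) (hτ₁ : τ₁ i ∈ Icc (M.vlo i) (M.vhi i)) {K : ℕ}
    (hK : K ≠ 0) :
    Integrable (fun ω => M.buyerRev i (avgThresholds M δ γ τ₁ (t · ω) (u · ω) K i)) P :=
  M.integrable_buyerRev_comp i
    ((Finset.measurable_sum _ fun k _ => h.measurable_thresholds k).div_const _) fun ω =>
      average_mem_Icc hK (thresholds_mem_Icc hδ hδw hτ₁ (t · ω) (u · ω))

theorem average_integral_le_integral_avgThresholds (h : M.IsSample P t u) (hM : M.Regular)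
    (hδ : 0 ≤ δ) (hδw : 2 * δ ≤ M.vhi i - M.vlo i) (hτ₁ : τ₁ i ∈ Icc (M.vlo i) (M.vhi i))
    {K : ℕ} (hK : K ≠ 0) :
    (∑ k ∈ Finset.range K, ∫ ω, M.buyerRev i (thresholds M δ γ τ₁ (t · ω) (u · ω) k i) ∂P) / K ≤
      ∫ ω, M.buyerRev i (avgThresholds M δ γ τ₁ (t · ω) (u · ω) K i) ∂P := by
  have hint : ∀ k, Integrable
      (fun ω => M.buyerRev i (thresholds M δ γ τ₁ (t · ω) (u · ω) k i)) P := fun k =>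
    M.integrable_buyerRev_comp i (h.measurable_thresholds k) fun ω =>
      thresholds_mem_Icc hδ hδw hτ₁ (t · ω) (u · ω) k
  rw [← integral_finsetSum _ fun k _ => hint k, ← integral_div]
  refine integral_mono ((integrable_finsetSum _ fun k _ => hint k).div_const _)
    (h.integrable_buyerRev_avgThresholds hδ hδw hτ₁ hK) fun ω => ?_
  exact average_le_map_average hK
    ((hM.isSupergradientOn_buyerRev i).concaveOn (convex_Icc _ _))
    (thresholds_mem_Icc hδ hδw hτ₁ (t · ω) (u · ω))

theorem buyerRev_sub_integral_le (h : M.IsSample P t u) (hM : M.Regular) (hB : M.vhi i ≤ B)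
    (hc : M.causedExt i ≤ B) (hδ : 0 < δ) (hγ : 0 < γ) (hδw : 2 * δ ≤ w)
    (hwi : w ≤ M.vhi i - M.vlo i) (hτ₁ : τ₁ i ∈ Icc (M.vlo i) (M.vhi i)) {K : ℕ} (hK : K ≠ 0)
    {σ : ℝ} (hσ : σ ∈ Icc (M.vlo i) (M.vhi i)) :
    M.buyerRev i σ - ∫ ω, M.buyerRev i (avgThresholds M δ γ τ₁ (t · ω) (u · ω) K i) ∂P ≤
      regretBound w B δ γ K := by
  obtain ⟨m, rfl⟩ := Nat.exists_eq_succ_of_ne_zero hK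
  have hB0 : 0 ≤ B := (M.causedExt_nonneg i).trans hc
  have hw : 0 < w := by linarith
  have hsum := h.le_sum_integral_buyerRev (τ₁ := τ₁) hM hB hc hδ hγ (hδw.trans hwi) hσ m
  have haverage := h.average_integral_le_integral_avgThresholds (γ := γ) hM hδ.le
    (hδw.trans hwi) hτ₁ hK
  have hfirst : 0 ≤ ∫ ω, M.buyerRev i (thresholds M δ γ τ₁ (t · ω) (u · ω) 0 i) ∂P :=
    integral_nonneg fun _ => M.buyerRev_nonneg i hτ₁
  have hσB := M.buyerRev_le i (hσ.2.trans hB) hc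
  have hmargin : 2 * δ / (M.vhi i - M.vlo i) * B ≤ 2 * δ / w * B := by gcongr
  rw [Finset.sum_range_succ', Nat.succ_eq_add_one, div_le_iff₀ (by positivity)] at haverage
  set A := ∫ ω, M.buyerRev i (avgThresholds M δ γ τ₁ (t · ω) (u · ω) (m + 1) i) ∂P
  set S := ∑ k ∈ Finset.range m,
    ∫ ω, M.buyerRev i (thresholds M δ γ τ₁ (t · ω) (u · ω) (k + 1) i) ∂P
  have hbound : ((m + 1 : ℕ) : ℝ) * regretBound w B δ γ (m + 1) = (m + 1) * (2 * δ / w * B) +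
      3 / (2 * γ) * (B ^ 2 + (m + 1) * (γ ^ 2 * (B / δ) ^ 2)) + B := by
    unfold regretBound
    push_cast
    field_simp
    ring
  have hmargin' : m * (2 * δ / (M.vhi i - M.vlo i) * B) ≤ (m + 1) * (2 * δ / w * B) :=
    (mul_le_mul_of_nonneg_left hmargin m.cast_nonneg).trans
      (mul_le_mul_of_nonneg_right (by linarith) (by positivity))
  have hvariance : 3 / (2 * γ) * (B ^ 2 + m * (γ ^ 2 * (B / δ) ^ 2)) ≤
      3 / (2 * γ) * (B ^ 2 + (m + 1) * (γ ^ 2 * (B / δ) ^ 2)) := by gcongr; linarith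
  refine le_of_mul_le_mul_left (a := ((m + 1 : ℕ) : ℝ)) ?_ (by positivity)
  rw [hbound]
  push_cast at haverage ⊢
  linarith

theorem integrable_learnedRev (h : M.IsSample P t u) (hδ : 0 ≤ δ)
    (hδw : ∀ i, 2 * δ ≤ M.vhi i - M.vlo i) (hτ₁ : ∀ i, τ₁ i ∈ Icc (M.vlo i) (M.vhi i)) {K : ℕ}
    (hK : K ≠ 0) : Integrable (fun ω => learnedRev M δ γ τ₁ (t · ω) (u · ω) K) P := by
  simp_rw [learnedRev, rev_postedPrice]
  exact integrable_finsetSum _ fun i _ =>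
    h.integrable_buyerRev_avgThresholds hδ (hδw i) (hτ₁ i) hK

theorem sum_buyerRev_sub_integral_learnedRev_le (h : M.IsSample P t u) (hM : M.Regular)
    (hB : ∀ i, M.vhi i ≤ B) (hc : ∀ i, M.causedExt i ≤ B) (hδ : 0 < δ) (hγ : 0 < γ)
    (hδw : 2 * δ ≤ w) (hw : ∀ i, w ≤ M.vhi i - M.vlo i)
    (hτ₁ : ∀ i, τ₁ i ∈ Icc (M.vlo i) (M.vhi i)) {K : ℕ} (hK : K ≠ 0) {σ : Fin n → ℝ}
    (hσ : ∀ i, σ i ∈ Icc (M.vlo i) (M.vhi i)) :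
    ∑ i, M.buyerRev i (σ i) - ∫ ω, learnedRev M δ γ τ₁ (t · ω) (u · ω) K ∂P ≤
      n * regretBound w B δ γ K := by
  simp_rw [learnedRev, rev_postedPrice]
  rw [integral_finsetSum _ fun i _ =>
    h.integrable_buyerRev_avgThresholds hδ.le (hδw.trans (hw i)) (hτ₁ i) hK,
    ← Finset.sum_sub_distrib]
  refine (Finset.sum_le_card_nsmul _ _ _ fun i _ =>
    h.buyerRev_sub_integral_le hM (hB i) (hc i) hδ hγ hδw (hw i) (hτ₁ i) hK (hσ i)).trans_eq ?_
  rw [Finset.card_univ, Fintype.card_fin, nsmul_eq_mul]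

end Market.IsSample

end Regret

/-- With `δ` of order `K ^ (-1/4)` and `γ` of order `K ^ (-3/4)`, the first three terms of
`regretBound` are of the same order `K ^ (-1/4)`. -/
theorem exists_regretBound_le {w : ℝ} (hw : 0 < w) (B : ℝ) :
    ∃ C : ℝ, ∀ K : ℕ, 1 ≤ K → ∃ δ γ : ℝ, 0 < δ ∧ 2 * δ < w ∧ 0 < γ ∧
      regretBound w B δ γ K ≤ C / (K : ℝ) ^ (1 / 4 : ℝ) := by
  refine ⟨B / 2 + 3 * B ^ 2 / 2 + 24 * B ^ 2 / w ^ 2 + |B|, fun K hK => ?_⟩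
  have hK1 : (1 : ℝ) ≤ K := by exact_mod_cast hK
  set r := (K : ℝ) ^ (1 / 4 : ℝ)
  have hr1 : 1 ≤ r := Real.one_le_rpow hK1 (by norm_num)
  have hr4 : (K : ℝ) = r ^ 4 := by
    rw [← Real.rpow_natCast, ← Real.rpow_mul (by positivity)]
    norm_num
  have hr0 : 0 < r := one_pos.trans_le hr1
  refine ⟨w / (4 * r), 1 / r ^ 3, by positivity, ?_, by positivity, ?_⟩
  · rw [← mul_div_assoc, div_lt_iff₀ (by positivity)]
    nlinarith
  have hfirst : B / r ^ 4 ≤ |B| / r :=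
    div_le_div₀ (abs_nonneg B) (le_abs_self B) hr0 (le_self_pow₀ hr1 (by norm_num))
  calc regretBound w B (w / (4 * r)) (1 / r ^ 3) K
      = B / 2 / r + 3 * B ^ 2 / 2 / r + 24 * B ^ 2 / w ^ 2 / r + B / r ^ 4 := by
        rw [regretBound, hr4]
        field_simp
        ring
    _ ≤ (B / 2 + 3 * B ^ 2 / 2 + 24 * B ^ 2 / w ^ 2 + |B|) / r := by
        simp only [add_div]
        linarith

/-! ### Incentive compatible mechanisms -/

theorem measurePreserving_pi_update {ι : Type*} [Fintype ι] [DecidableEq ι] {X : ι → Type*}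
    [∀ j, MeasurableSpace (X j)] (μ : ∀ j, Measure (X j)) [∀ j, IsProbabilityMeasure (μ j)]
    (i : ι) :
    MeasurePreserving (fun z : X i × (∀ j, X j) => Function.update z.2 i z.1)
      ((μ i).prod (Measure.pi μ)) (Measure.pi μ) := by
  have hmeas : Measurable fun z : X i × (∀ j, X j) => Function.update z.2 i z.1 :=
    measurable_update'.comp measurable_swap
  refine ⟨hmeas, (Measure.pi_eq fun s hs => ?_).symm⟩
  have hpreimage : (fun z : X i × (∀ j, X j) => Function.update z.2 i z.1) ⁻¹' univ.pi s =
      s i ×ˢ univ.pi (Function.update s i univ) := by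
    ext z
    simp [Function.forall_update_iff (f := z.2) (p := fun j x => x ∈ s j),
      Function.forall_update_iff (f := s) (p := fun j S => z.2 j ∈ S)]
  have hupdate : (fun j => μ j (Function.update s i univ j)) =
      Function.update (fun j => μ j (s j)) i 1 := by
    ext j
    rw [Function.apply_update (fun j => μ j), measure_univ]
  rw [Measure.map_apply hmeas (MeasurableSet.univ_pi hs), hpreimage, Measure.prod_prod,
    Measure.pi_pi, hupdate, Finset.prod_update_of_mem (Finset.mem_univ i), one_mul,
    Finset.prod_eq_mul_prod_sdiff_singleton_of_mem (Finset.mem_univ i)]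

/-- Layer cake: `q` is the average over `t ∈ (0, 1]` of the indicators of its superlevel sets. -/
theorem le_integral_mul_of_forall_le_setIntegral {α : Type*} [MeasurableSpace α] {μ : Measure α}
    [SFinite μ] {ψ q : α → ℝ} {k : ℝ} (hψ : Integrable ψ μ) (hq : AEMeasurable q μ)
    (hq01 : ∀ᵐ x ∂μ, q x ∈ Icc (0 : ℝ) 1) (hk : ∀ t, k ≤ ∫ x in {x | t ≤ q x}, ψ x ∂μ) :
    k ≤ ∫ x, ψ x * q x ∂μ := by
  have hint : Integrable
      (fun z : α × ℝ => {z : α × ℝ | z.2 ≤ q z.1}.indicator (fun z => ψ z.1) z)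
      (μ.prod (volume.restrict (Ioc 0 1))) :=
    (hψ.comp_fst _).indicator₀ (nullMeasurableSet_le measurable_snd.aemeasurable hq.comp_fst)
  have hlayer : ∀ᵐ x ∂μ, ψ x * q x =
      ∫ t in Ioc (0 : ℝ) 1, {z : α × ℝ | z.2 ≤ q z.1}.indicator (fun z => ψ z.1) (x, t) := by
    filter_upwards [hq01] with x hx
    have hslice : (fun t : ℝ => {z : α × ℝ | z.2 ≤ q z.1}.indicator (fun z => ψ z.1) (x, t)) =
        (Iic (q x)).indicator fun _ => ψ x := rfl
    rw [hslice, integral_indicator measurableSet_Iic, Measure.restrict_restrict measurableSet_Iic,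
      setIntegral_const, inter_comm, Ioc_inter_Iic, min_eq_right hx.2,
      Real.volume_real_Ioc_of_le hx.1, sub_zero, smul_eq_mul, mul_comm]
  rw [integral_congr_ae hlayer, integral_integral_swap hint]
  calc k = ∫ _ in Ioc (0 : ℝ) 1, k := by simp
    _ ≤ _ := integral_mono (integrable_const k) hint.integral_prod_right fun t => ?_
  exact (hk t).trans_eq
    (integral_indicator₀ (nullMeasurableSet_le aemeasurable_const hq)).symm

theorem exists_ae_eq_Ioc_of_forall_mem {a b : ℝ} (hab : a ≤ b) {s : Set ℝ} (hs : s ⊆ Ioc a b)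
    (hupper : ∀ x ∈ s, ∀ y ∈ Ioc a b, x ≤ y → y ∈ s) :
    ∃ x ∈ Icc a b, s =ᵐ[volume] Ioc x b := by
  rcases s.eq_empty_or_nonempty with rfl | ⟨z, hz⟩
  · exact ⟨b, right_mem_Icc.2 hab, by rw [Ioc_self]; rfl⟩
  have hbdd : BddBelow s := ⟨a, fun x hx => (hs hx).1.le⟩
  refine ⟨sInf s, ⟨le_csInf ⟨z, hz⟩ fun x hx => (hs hx).1.le, (csInf_le hbdd hz).trans (hs hz).2⟩,
    ?_⟩
  have hleft : Ioc (sInf s) b ⊆ s := fun y hy => by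
    obtain ⟨x, hx, hxy⟩ := exists_lt_of_csInf_lt ⟨z, hz⟩ hy.1
    exact hupper x hx y ⟨(hs hx).1.trans hxy, hy.2⟩ hxy.le
  have hright : s ⊆ Icc (sInf s) b := fun x hx => ⟨csInf_le hbdd hx, (hs hx).2⟩
  exact (hright.eventuallyLE.trans Ioc_ae_eq_Icc.symm.le).antisymm hleft.eventuallyLE

theorem intervalIntegrable_mul_of_monotoneOn {f q : ℝ → ℝ} {a b : ℝ}
    (hf : IntervalIntegrable f volume a b) (hq : MonotoneOn q (uIcc a b)) :
    IntervalIntegrable (fun v => f v * q v) volume a b := by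
  rw [intervalIntegrable_iff] at hf ⊢
  refine hf.mul_bdd (c := max |q (min a b)| |q (max a b)|)
    (aemeasurable_restrict_of_monotoneOn measurableSet_uIoc
      (hq.mono uIoc_subset_uIcc)).aestronglyMeasurable ?_
  filter_upwards [ae_restrict_mem measurableSet_uIoc] with v hv
  have hv' := uIoc_subset_uIcc hv
  exact abs_le_max_abs_abs (hq ⟨le_rfl, min_le_max⟩ hv' hv'.1) (hq hv' ⟨min_le_max, le_rfl⟩ hv'.2)

theorem le_intervalIntegral_mul_of_monotoneOn {ψ q : ℝ → ℝ} {a b k : ℝ} (hab : a ≤ b)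
    (hψ : IntervalIntegrable ψ volume a b) (hq : MonotoneOn q (Icc a b))
    (hq01 : ∀ x ∈ Icc a b, q x ∈ Icc (0 : ℝ) 1) (hk : ∀ x ∈ Icc a b, k ≤ ∫ v in x..b, ψ v) :
    k ≤ ∫ v in a..b, ψ v * q v := by
  have hqm : AEMeasurable q (volume.restrict (Ioc a b)) :=
    aemeasurable_restrict_of_monotoneOn measurableSet_Ioc (hq.mono Ioc_subset_Icc_self)
  rw [intervalIntegral.integral_of_le hab]
  refine le_integral_mul_of_forall_le_setIntegral hψ.1 hqm
    ((ae_restrict_mem measurableSet_Ioc).mono fun x hx => hq01 x (Ioc_subset_Icc_self hx))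
    fun t => ?_
  obtain ⟨x, hx, hae⟩ := exists_ae_eq_Ioc_of_forall_mem (s := {v | t ≤ q v} ∩ Ioc a b) hab
    inter_subset_right fun v hv y hy hvy =>
      ⟨hv.1.trans (hq (Ioc_subset_Icc_self hv.2) (Ioc_subset_Icc_self hy) hvy), hy⟩
  rw [Measure.restrict_restrict₀ (nullMeasurableSet_le aemeasurable_const hqm),
    setIntegral_congr_set hae, ← intervalIntegral.integral_of_le hx.2]
  exact hk x hx

namespace Market

variable {n : ℕ} (M : Market n) (i : Fin n)

theorem integrable_valueLaw_of_monotoneOn {q : ℝ → ℝ}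
    (hq : MonotoneOn q (Icc (M.vlo i) (M.vhi i))) : Integrable q (M.valueLaw i) := by
  have hqm := aemeasurable_restrict_of_monotoneOn (μ := M.valueLaw i) measurableSet_Icc hq
  rw [Measure.restrict_eq_self_of_ae_mem (M.ae_mem_Icc_valueLaw i)] at hqm
  exact Integrable.of_mem_Icc (q (M.vlo i)) (q (M.vhi i)) hqm
    ((M.ae_mem_Icc_valueLaw i).mono fun v hv =>
      ⟨hq (M.vlo_mem i) hv hv.1, hq hv (M.vhi_mem i) hv.2⟩)

/-- Integration by parts: the rent `u` contributes only through its value at the lowest type. -/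
theorem integral_sub_mul_sub_eq {q u : ℝ → ℝ}
    (h : IsSupergradientOn (-q) (-u) (Icc (M.vlo i) (M.vhi i))) :
    ∫ v, ((v - M.causedExt i) * q v - u v) ∂M.valueLaw i =
      -(∫ v in M.vlo i..M.vhi i, M.marginalRev i v * q v) - u (M.vlo i) := by
  have hab := (M.vlo_lt_vhi i).le
  have hdensity := M.intervalIntegrable_density i (M.vlo_mem i) (M.vhi_mem i)
  have hu : ContinuousOn u (uIcc (M.vlo i) (M.vhi i)) := by
    simpa [uIcc_of_le hab] using h.continuousOn.neg
  have hq : MonotoneOn q (uIcc (M.vlo i) (M.vhi i)) := by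
    simpa [uIcc_of_le hab] using h.antitoneOn.neg
  have hparts := integral_mul_add_mul_of_primitive (F := fun v => M.valueCDF i v - 1) (G := u)
    (g := q) hab hdensity hq.intervalIntegrable
    (fun v hv => by rw [← M.valueCDF_sub_valueCDF i (M.vlo_mem i) hv]; ring)
    (fun v hv => by
      have := h.integral_eq (M.vlo_mem i) hv
      simp only [Pi.neg_apply, intervalIntegral.integral_neg] at this
      linarith)
  rw [M.valueCDF_vhi, M.valueCDF_vlo] at hparts
  have hmarginal : ∀ v, M.density i v * ((v - M.causedExt i) * q v - u v) =
      -(M.marginalRev i v * q v +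
        (M.density i v * u v + (M.valueCDF i v - 1) * q v)) := fun v => by
    rw [marginalRev]
    ring
  have hcdf : IntervalIntegrable (fun v => M.valueCDF i v - 1) volume (M.vlo i) (M.vhi i) :=
    (M.monotone_valueCDF i).intervalIntegrable.sub intervalIntegrable_const
  rw [M.integral_valueLaw]
  simp_rw [hmarginal]
  rw [intervalIntegral.integral_neg, intervalIntegral.integral_add
    (intervalIntegrable_mul_of_monotoneOn
      (M.intervalIntegrable_marginalRev i (M.vlo_mem i) (M.vhi_mem i)) hq)
    ((hdensity.mul_continuousOn hu).add (intervalIntegrable_mul_of_monotoneOn hcdf hq)), hparts]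
  ring

theorem causedExt_sub_integral_le {q : ℝ → ℝ} {σ : ℝ}
    (hσ : IsMaxOn (M.buyerRev i) (Icc (M.vlo i) (M.vhi i)) σ)
    (hq : MonotoneOn q (Icc (M.vlo i) (M.vhi i)))
    (hq01 : ∀ v ∈ Icc (M.vlo i) (M.vhi i), q v ∈ Icc (0 : ℝ) 1) :
    M.causedExt i - ∫ v in M.vlo i..M.vhi i, M.marginalRev i v * q v ≤ M.buyerRev i σ := by
  have hvhi : M.buyerRev i (M.vhi i) = M.causedExt i := by
    rw [buyerRev, M.valueCDF_vhi]
    ring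
  have hle := le_intervalIntegral_mul_of_monotoneOn (k := M.causedExt i - M.buyerRev i σ)
    (M.vlo_lt_vhi i).le (M.intervalIntegrable_marginalRev i (M.vlo_mem i) (M.vhi_mem i)) hq hq01
    fun x hx => by
      rw [M.integral_marginalRev i hx (M.vhi_mem i), hvhi]
      exact sub_le_sub_left (hσ hx) _
  linarith

end Market

theorem truthful_update {n : ℕ} (t : Profile n) (i : Fin n) (s : BidderType n i) :
    truthful (Function.update t i s) = Function.update (truthful t) i (some s) :=
  funext fun j => Function.apply_update (fun _ => some) t i s j

theorem externality_update_self {n : ℕ} (t : Profile n) (i : Fin n) (s : BidderType n i)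
    (j : {j : Fin n // j ≠ i}) :
    externality (Function.update t i s) i j = externality t i j := by
  simp only [externality, Function.update_of_ne j.2]

theorem externality_update_other {n : ℕ} (t : Profile n) {i : Fin n} (j : {j : Fin n // j ≠ i})
    (s : BidderType n j) : externality (Function.update t j s) i j = s.2 ⟨i, j.2.symm⟩ := by
  simp only [externality, Function.update_self]

namespace Market

variable {n : ℕ} (M : Market n) (i : Fin n)

theorem measurePreserving_update :
    MeasurePreserving (fun z : BidderType n i × Profile n => Function.update z.2 i z.1)
      (((M.valueLaw i).prod (M.extLaw i)).prod M.typeLaw) M.typeLaw :=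
  measurePreserving_pi_update (fun i => (M.valueLaw i).prod (M.extLaw i)) i

theorem integral_integral_update {f : Profile n → ℝ} (hf : Integrable f M.typeLaw) :
    ∫ s, ∫ t, f (Function.update t i s) ∂M.typeLaw ∂(M.valueLaw i).prod (M.extLaw i) =
      ∫ t, f t ∂M.typeLaw := by
  have hmp := M.measurePreserving_update i
  rw [← integral_prod (fun z : BidderType n i × Profile n => f (Function.update z.2 i z.1))
    (hmp.integrable_comp_of_integrable hf)]
  conv_rhs => rw [← hmp.map_eq]
  exact (integral_map hmp.measurable.aemeasurable
    (hmp.map_eq.symm ▸ hf.aestronglyMeasurable)).symm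

theorem ae_mem_typeSpace : ∀ᵐ s ∂(M.valueLaw i).prod (M.extLaw i), s ∈ M.typeSpace i :=
  (Measure.quasiMeasurePreserving_fst.ae (M.ae_mem_Icc_valueLaw i)).and
    (Measure.quasiMeasurePreserving_snd.ae (M.extLaw_range i))

theorem integrable_externality (j : {j : Fin n // j ≠ i}) :
    Integrable (fun t => externality t i j) M.typeLaw :=
  (M.measurePreserving_ext j).integrable_comp_of_integrable (M.integrable_extLaw j ⟨i, j.2.symm⟩)

theorem integral_externality (j : {j : Fin n // j ≠ i}) :
    ∫ t, externality t i j ∂M.typeLaw = M.meanExt i j := by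
  rw [meanExt, ← (M.measurePreserving_ext j).map_eq, integral_map
    (M.measurePreserving_ext j).measurable.aemeasurable
    (measurable_pi_apply _).aestronglyMeasurable]
  rfl

theorem ae_externality_nonneg (j : {j : Fin n // j ≠ i}) :
    ∀ᵐ t ∂M.typeLaw, 0 ≤ externality t i j :=
  (M.measurePreserving_ext j).quasiMeasurePreserving.ae (M.ae_extLaw_nonneg j ⟨i, j.2.symm⟩)

theorem integrable_externality_mul (j : {j : Fin n // j ≠ i}) {x : Profile n → ℝ}
    (hx : Measurable x) (hx01 : ∀ t, x t ∈ Icc (0 : ℝ) 1) :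
    Integrable (fun t => externality t i j * x t) M.typeLaw :=
  (M.integrable_externality i j).mul_bdd (c := 1) hx.aestronglyMeasurable
    (Filter.Eventually.of_forall fun t => (abs_of_nonneg (hx01 t).1).trans_le (hx01 t).2)

end Market

namespace Mechanism

variable {n : ℕ} (m : Mechanism n) (M : Market n) (i : Fin n)

/-- The interim allocation of buyer `i` when she bids `s`: her probability of getting the good,
over the truthful bids of the others. -/
noncomputable def interimAlloc (s : BidderType n i) : ℝ :=
  ∫ t, m.alloc (truthful (Function.update t i s)) i ∂M.typeLaw

/-- What the mechanism costs buyer `i` when everybody bids truthfully: the externalities she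
suffers and her payment. -/
def cost (t : Profile n) : ℝ :=
  ∑ j : {j : Fin n // j ≠ i}, externality t i j * m.alloc (truthful t) j + m.pay (truthful t) i

/-- The interim cost of buyer `i` when she bids `s`: her expected cost over the truthful bids of
the others. -/
noncomputable def interimCost (s : BidderType n i) : ℝ :=
  ∫ t, m.cost i (Function.update t i s) ∂M.typeLaw

namespace Feasible

variable {m M}

theorem integrable_alloc_update (h : m.Feasible M) (s : BidderType n i) (j : Fin n) :
    Integrable (fun t => m.alloc (truthful (Function.update t i s)) j) M.typeLaw :=
  Integrable.of_mem_Icc 0 1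
    ((h.alloc_measurable j).comp measurable_update_left).aemeasurable
    (Filter.Eventually.of_forall fun _ => h.alloc_mem _ _)

theorem integrable_externality_mul_alloc (h : m.Feasible M) (j : {j : Fin n // j ≠ i}) :
    Integrable (fun t => externality t i j * m.alloc (truthful t) j) M.typeLaw :=
  M.integrable_externality_mul i j (h.alloc_measurable j) fun _ => h.alloc_mem _ _

theorem integrable_cost (h : m.Feasible M) : Integrable (m.cost i) M.typeLaw :=
  (integrable_finsetSum _ fun j _ => h.integrable_externality_mul_alloc i j).add
    (h.pay_integrable i)

theorem integrable_cost_update (h : m.Feasible M) {s : BidderType n i} (hs : s ∈ M.typeSpace i) :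
    Integrable (fun t => m.cost i (Function.update t i s)) M.typeLaw := by
  simp only [cost, externality_update_self]
  refine (integrable_finsetSum _ fun j _ => M.integrable_externality_mul i j
    ((h.alloc_measurable j).comp measurable_update_left) fun _ => h.alloc_mem _ _).add ?_
  simpa only [truthful_update] using h.pay_interim_integrable i s hs

theorem interimUtility_some (h : m.Feasible M) {s : BidderType n i} (hs : s ∈ M.typeSpace i)
    (t : BidderType n i) :
    m.interimUtility M i (some s) t = t.1 * m.interimAlloc M i s - m.interimCost M i s := by
  rw [interimAlloc, interimCost, ← integral_const_mul,
    ← integral_sub ((h.integrable_alloc_update i s i).const_mul _) (h.integrable_cost_update i hs)]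
  simp only [interimUtility, utility, cost, externality_update_self, Function.update_self,
    truthful_update, sub_sub]

theorem neg_sum_meanExt_le_interimUtility_none (h : m.Feasible M) (t : BidderType n i) :
    -∑ j : {j : Fin n // j ≠ i}, M.meanExt i j ≤ m.interimUtility M i none t := by
  have hout : ∀ t' : Profile n, m.alloc (Function.update (truthful t') i none) i = 0 ∧
      m.pay (Function.update (truthful t') i none) i = 0 := fun t' =>
    h.outside _ i (Function.update_self ..)
  have hint : ∀ j : {j : Fin n // j ≠ i}, Integrable (fun t' : Profile n =>
      externality t' i j * m.alloc (Function.update (truthful t') i none) j) M.typeLaw := fun j =>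
    M.integrable_externality_mul i j (h.alloc_out_measurable i j) fun _ => h.alloc_mem _ _
  simp only [interimUtility, utility, externality_update_self, (hout _).1, (hout _).2, mul_zero,
    zero_sub, sub_zero]
  rw [integral_neg, neg_le_neg_iff, integral_finsetSum _ fun j _ => hint j]
  refine Finset.sum_le_sum fun j _ => ?_
  rw [← M.integral_externality]
  refine integral_mono_ae (hint j) (M.integrable_externality i j) ?_
  filter_upwards [M.ae_externality_nonneg i j] with t' ht'
  exact mul_le_of_le_one_right ht' (h.alloc_mem _ _).2

theorem interimAlloc_mem (h : m.Feasible M) (s : BidderType n i) :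
    m.interimAlloc M i s ∈ Icc (0 : ℝ) 1 := by
  refine ⟨integral_nonneg fun t => (h.alloc_mem _ _).1, ?_⟩
  have hle := integral_mono (h.integrable_alloc_update i s i) (integrable_const (1 : ℝ))
    fun t => (h.alloc_mem _ _).2
  simpa [interimAlloc] using hle

end Feasible

/-- `q` and `u` describe the interim allocation and the interim utility of buyer `i` as functions
of her value alone: her externalities do not enter her utility, so truthful bidding makes `u`
well defined, convex with subgradient `q`, and makes `q` the interim allocation up to null
sets. -/
structure IsEnvelope (m : Mechanism n) (M : Market n) (i : Fin n) (q u : ℝ → ℝ) : Prop where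
  mem_Icc : ∀ v ∈ Icc (M.vlo i) (M.vhi i), q v ∈ Icc (0 : ℝ) 1
  isSupergradientOn_neg : IsSupergradientOn (-q) (-u) (Icc (M.vlo i) (M.vhi i))
  neg_sum_meanExt_le : -∑ j : {j : Fin n // j ≠ i}, M.meanExt i j ≤ u (M.vlo i)
  interimUtility_eq : ∀ s ∈ M.typeSpace i, m.interimUtility M i (some s) s = u s.1
  interimAlloc_ae_eq :
    ∀ᵐ s ∂(M.valueLaw i).prod (M.extLaw i), m.interimAlloc M i s = q s.1

variable {m M}

theorem exists_isEnvelope (h : m.Feasible M) (hIC : m.BNIC M) (hIR : m.InterimIR M) :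
    ∃ q u, m.IsEnvelope M i q u := by
  obtain ⟨η, hη⟩ := (M.extLaw_range i).exists
  have hmem : ∀ v ∈ Icc (M.vlo i) (M.vhi i), ((v, η) : BidderType n i) ∈ M.typeSpace i :=
    fun v hv => ⟨hv, hη⟩
  let q : ℝ → ℝ := fun v => m.interimAlloc M i (v, η)
  let u : ℝ → ℝ := fun v => m.interimUtility M i (some (v, η)) (v, η)
  have hvalue : ∀ s ∈ M.typeSpace i, m.interimUtility M i (some s) s = u s.1 := fun s hs => by
    have hle := hIC i (s.1, η) (hmem _ hs.1) s hs
    have hge := hIC i s hs (s.1, η) (hmem _ hs.1)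
    simp only [u, h.interimUtility_some i hs, h.interimUtility_some i (hmem _ hs.1)] at hle hge ⊢
    exact le_antisymm hle hge
  have hsub : ∀ s ∈ M.typeSpace i, ∀ y ∈ Icc (M.vlo i) (M.vhi i),
      (-u) y - (-u) s.1 ≤ -m.interimAlloc M i s * (y - s.1) := fun s hs y hy => by
    have hle := hIC i (y, η) (hmem y hy) s hs
    rw [hvalue _ (hmem y hy), h.interimUtility_some i hs] at hle
    simp only [Pi.neg_apply, ← hvalue s hs, h.interimUtility_some i hs]
    linarith
  have hsuper : IsSupergradientOn (-q) (-u) (Icc (M.vlo i) (M.vhi i)) := fun x hx y hy =>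
    hsub (x, η) (hmem x hx) y hy
  refine ⟨q, u, fun v _ => h.interimAlloc_mem i _, hsuper, ?_, hvalue, ?_⟩
  · exact (h.neg_sum_meanExt_le_interimUtility_none i _).trans (hIR i _ (hmem _ (M.vlo_mem i)))
  · filter_upwards [M.ae_mem_typeSpace i, Measure.quasiMeasurePreserving_fst.ae
      (hsuper.ae_continuousAt (M.valueLaw i))] with s hs hcont
    obtain ⟨hnhds, hq⟩ := hcont hs.1
    exact neg_injective (hsuper.eq_of_forall_sub_le hnhds hq (hsub s hs))

namespace IsEnvelope

variable {q u : ℝ → ℝ} {i}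

theorem monotoneOn (hqu : m.IsEnvelope M i q u) : MonotoneOn q (Icc (M.vlo i) (M.vhi i)) := by
  simpa using hqu.isSupergradientOn_neg.antitoneOn.neg

theorem monotoneOn_utility (hqu : m.IsEnvelope M i q u) :
    MonotoneOn u (Icc (M.vlo i) (M.vhi i)) := fun x hx y hy hxy => by
  have hsub := hqu.isSupergradientOn_neg hx hy
  have hnonneg := mul_nonneg (hqu.mem_Icc x hx).1 (sub_nonneg.2 hxy)
  simp only [Pi.neg_apply] at hsub
  linarith

theorem integrable_alloc (hqu : m.IsEnvelope M i q u) : Integrable q (M.valueLaw i) :=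
  M.integrable_valueLaw_of_monotoneOn i hqu.monotoneOn

theorem integrable_mul_sub (hqu : m.IsEnvelope M i q u) :
    Integrable (fun v => v * q v - u v) (M.valueLaw i) := by
  refine (M.integrable_valueLaw_of_monotoneOn i ?_).sub
    (M.integrable_valueLaw_of_monotoneOn i hqu.monotoneOn_utility)
  exact fun x hx y hy hxy => mul_le_mul hxy (hqu.monotoneOn hx hy hxy) (hqu.mem_Icc x hx).1
    ((M.vlo_nonneg i).trans hy.1)

theorem integral_cost (hqu : m.IsEnvelope M i q u) (h : m.Feasible M) :
    ∫ t, m.cost i t ∂M.typeLaw = ∫ v, (v * q v - u v) ∂M.valueLaw i := by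
  rw [← M.integral_integral_update i (h.integrable_cost i)]
  have hae : ∀ᵐ s ∂(M.valueLaw i).prod (M.extLaw i),
      ∫ t, m.cost i (Function.update t i s) ∂M.typeLaw = s.1 * q s.1 - u s.1 := by
    filter_upwards [M.ae_mem_typeSpace i, hqu.interimAlloc_ae_eq] with s hs hq
    rw [← hqu.interimUtility_eq s hs, h.interimUtility_some i hs, hq, interimCost, sub_sub_cancel]
  rw [integral_congr_ae hae, integral_fun_fst fun v => v * q v - u v, probReal_univ, one_smul]

theorem integral_externality_mul_alloc {j : {j : Fin n // j ≠ i}}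
    (hqu : m.IsEnvelope M j q u) (h : m.Feasible M) :
    ∫ t, externality t i j * m.alloc (truthful t) j ∂M.typeLaw =
      M.meanExt i j * ∫ v, q v ∂M.valueLaw j := by
  rw [← M.integral_integral_update j (h.integrable_externality_mul_alloc i j)]
  simp_rw [externality_update_other, integral_const_mul]
  have hae : ∀ᵐ s ∂(M.valueLaw j).prod (M.extLaw j), s.2 ⟨i, j.2.symm⟩ *
      ∫ t, m.alloc (truthful (Function.update t j s)) j ∂M.typeLaw =
        q s.1 * s.2 ⟨i, j.2.symm⟩ := by
    filter_upwards [hqu.interimAlloc_ae_eq] with s hq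
    rw [← hq, mul_comm, interimAlloc]
  rw [integral_congr_ae hae,
    integral_prod_mul q fun η : {k : Fin n // k ≠ j} → ℝ => η ⟨i, j.2.symm⟩, mul_comm,
    Market.meanExt]

theorem integral_sub_mul_sub_le (hqu : m.IsEnvelope M i q u) {σ : ℝ}
    (hσ : IsMaxOn (M.buyerRev i) (Icc (M.vlo i) (M.vhi i)) σ) :
    ∫ v, (v * q v - u v) ∂M.valueLaw i - M.causedExt i * ∫ v, q v ∂M.valueLaw i ≤
      M.buyerRev i σ - (M.causedExt i + u (M.vlo i)) := by
  have hparts := M.integral_sub_mul_sub_eq i hqu.isSupergradientOn_neg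
  have hbound := M.causedExt_sub_integral_le i hσ hqu.monotoneOn hqu.mem_Icc
  have hsplit : (fun v => (v - M.causedExt i) * q v - u v) =
      fun v => (v * q v - u v) - M.causedExt i * q v := by
    ext v
    ring
  rw [hsplit, integral_sub hqu.integrable_mul_sub (hqu.integrable_alloc.const_mul _),
    integral_const_mul] at hparts
  linarith

end IsEnvelope

theorem rev_eq_of_isEnvelope (h : m.Feasible M) {q u : Fin n → ℝ → ℝ}
    (hqu : ∀ i, m.IsEnvelope M i (q i) (u i)) :
    m.rev M = ∑ i, (∫ v, (v * q i v - u i v) ∂M.valueLaw i -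
      M.causedExt i * ∫ v, q i v ∂M.valueLaw i) := by
  have hpay : ∀ i, ∫ t, m.pay (truthful t) i ∂M.typeLaw =
      ∫ v, (v * q i v - u i v) ∂M.valueLaw i -
        ∑ j : {j : Fin n // j ≠ i}, M.meanExt i j * ∫ v, q j v ∂M.valueLaw j := fun i => by
    rw [← (hqu i).integral_cost h, eq_sub_iff_add_eq']
    simp only [cost]
    rw [integral_add (integrable_finsetSum _ fun j _ => h.integrable_externality_mul_alloc i j)
        (h.pay_integrable i), integral_finsetSum _ fun j _ =>
        h.integrable_externality_mul_alloc i j]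
    simp_rw [fun j : {j : Fin n // j ≠ i} => (hqu j).integral_externality_mul_alloc h]
  rw [rev, integral_finsetSum _ fun i _ => h.pay_integrable i]
  simp_rw [hpay]
  rw [Finset.sum_sub_distrib, M.sum_sum_meanExt_mul fun j => ∫ v, q j v ∂M.valueLaw j,
    ← Finset.sum_sub_distrib]

theorem exists_thresholds_rev_le (h : m.Feasible M) (hIC : m.BNIC M) (hIR : m.InterimIR M) :
    ∃ σ : Fin n → ℝ, (∀ i, σ i ∈ Icc (M.vlo i) (M.vhi i)) ∧
      m.rev M ≤ ∑ i, M.buyerRev i (σ i) := by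
  choose q u hqu using fun i => exists_isEnvelope i h hIC hIR
  choose σ hσ hmax using fun i => isCompact_Icc.exists_isMaxOn ⟨_, M.vlo_mem i⟩
    (M.continuousOn_buyerRev i)
  have hexternalities := M.sum_sum_meanExt_mul fun _ => 1
  have hrent : -∑ i, M.causedExt i ≤ ∑ i, u i (M.vlo i) := by
    simp only [mul_one] at hexternalities
    rw [← hexternalities, ← Finset.sum_neg_distrib]
    exact Finset.sum_le_sum fun i _ => (hqu i).neg_sum_meanExt_le
  refine ⟨σ, hσ, ?_⟩
  calc m.rev M ≤ ∑ i, (M.buyerRev i (σ i) - (M.causedExt i + u i (M.vlo i))) := by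
        rw [rev_eq_of_isEnvelope h hqu]
        exact Finset.sum_le_sum fun i _ => (hqu i).integral_sub_mul_sub_le (hmax i)
    _ ≤ ∑ i, M.buyerRev i (σ i) := by
        rw [Finset.sum_sub_distrib, Finset.sum_add_distrib]
        linarith

end Mechanism

end DataMarket

theorem mainTheorem8 (w B : ℝ) (hw : 0 < w) :
    ∃ C : ℝ, ∀ K : ℕ, 1 ≤ K → ∃ δ γ : ℝ, 0 < δ ∧ 2 * δ < w ∧ 0 < γ ∧
      ∀ (n : ℕ) (M : DataMarket.Market n), M.Regular →
        (∀ i, w ≤ M.vhi i - M.vlo i) → (∀ i, M.vhi i ≤ B) → (∀ i, M.causedExt i ≤ B) →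
      ∀ τ₁ : Fin n → ℝ, (∀ i, τ₁ i ∈ Set.Icc (M.vlo i) (M.vhi i)) →
      ∀ (Ω : Type*) [MeasurableSpace Ω] (P : MeasureTheory.Measure Ω)
        [MeasureTheory.IsProbabilityMeasure P]
        (t : ℕ → Ω → DataMarket.Profile n) (u : ℕ → Ω → Fin n → ℝ),
        (∀ k, Measurable (t k)) → (∀ k, Measurable (u k)) →
        ProbabilityTheory.iIndepFun (fun k ω => (t k ω, u k ω)) P →
        (∀ k, P.map (fun ω => (t k ω, u k ω)) = M.typeLaw.prod (DataMarket.noiseLaw n)) →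
        MeasureTheory.Integrable
          (fun ω => DataMarket.learnedRev M δ γ τ₁ (fun k => t k ω) (fun k => u k ω) K) P ∧
        (∀ τ : Fin n → ℝ, (∀ i, τ i ∈ Set.Icc (M.vlo i) (M.vhi i)) →
          (DataMarket.postedPrice M τ).rev M -
              ∫ ω, DataMarket.learnedRev M δ γ τ₁ (fun k => t k ω) (fun k => u k ω) K ∂P
            ≤ C * (n / (K : ℝ) ^ (1 / 4 : ℝ))) ∧
        (∀ m : DataMarket.Mechanism n, m.Feasible M → m.BNIC M → m.InterimIR M →
          m.rev M -
              ∫ ω, DataMarket.learnedRev M δ γ τ₁ (fun k => t k ω) (fun k => u k ω) K ∂P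
            ≤ C * (n / (K : ℝ) ^ (1 / 4 : ℝ))) := by
  obtain ⟨C, hC⟩ := DataMarket.exists_regretBound_le hw B
  refine ⟨C, fun K hK => ?_⟩
  obtain ⟨δ, γ, hδ, hδw, hγ, hle⟩ := hC K hK
  refine ⟨δ, γ, hδ, hδw, hγ, fun n M hM hMw hMB hMc τ₁ hτ₁ Ω _ P _ t u ht hu hind hlaw => ?_⟩
  have hsample : M.IsSample P t u := ⟨ht, hu, hind, hlaw⟩
  have hK0 : K ≠ 0 := Nat.one_le_iff_ne_zero.1 hK
  have hregret : ∀ σ : Fin n → ℝ, (∀ i, σ i ∈ Set.Icc (M.vlo i) (M.vhi i)) →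
      ∑ i, M.buyerRev i (σ i) - ∫ ω, DataMarket.learnedRev M δ γ τ₁ (t · ω) (u · ω) K ∂P ≤
        C * (n / (K : ℝ) ^ (1 / 4 : ℝ)) := fun σ hσ =>
    calc _ ≤ n * DataMarket.regretBound w B δ γ K :=
          hsample.sum_buyerRev_sub_integral_learnedRev_le hM hMB hMc hδ hγ hδw.le hMw hτ₁ hK0 hσ
      _ ≤ n * (C / (K : ℝ) ^ (1 / 4 : ℝ)) := mul_le_mul_of_nonneg_left hle n.cast_nonneg
      _ = C * (n / (K : ℝ) ^ (1 / 4 : ℝ)) := by ring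
  refine ⟨hsample.integrable_learnedRev hδ.le (fun i => hδw.le.trans (hMw i)) hτ₁ hK0,
    fun τ hτ => ?_, fun m hm hIC hIR => ?_⟩
  · rw [M.rev_postedPrice]
    exact hregret τ hτ
  · obtain ⟨σ, hσ, hrev⟩ := DataMarket.Mechanism.exists_thresholds_rev_le hm hIC hIR
    exact (sub_le_sub_right hrev _).trans (hregret σ hσ)
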